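/- Notation. For $x=(x_1,x_2)\in\mathbb R^2$ let $x^\perp=(-x_2,x_1)$. $\mathcal M_+(\mathbb R^2)$ (resp. $\mathcal M(\mathbb R^2)$) is the set of finite positive (resp. finite signed) Borel measures, and $C_0$ denotes continuous functions vanishing at infinity. $C_w(\mathbb R_+,\mathcal M_+(\mathbb R^2))$ is the set of maps $\rho:\mathbb R_+\to\mathcal M_+(\mathbb R^2)$ such that $t\mapsto\int\varphi\,d\rho(t)$ is continuous for all $\varphi\in C_0(\mathbb R^2)$; $\rho_n\to\rho$ in it means that $\int\varphi\,d\rho_n(t)\to\int\varphi\,d\rho(t)$ uniformly on $[0,T]$, for all $T>0$ and $\varphi\in C_0(\mathbb R^2)$. For $\Phi\in C_c^\infty(\mathbb R^2)$ and $\mu\in\mathcal M_+(\mathbb R^2)$ let $$\mathcal H_\Phi[\mu,\mu]=\frac12\iint H_\Phi(x,y)\,d\mu(x)\,d\mu(y),\qquad H_\Phi(x,y)=\frac{(x-y)^\perp}{|x-y|^2}\cdot(\nabla\Phi(x)-\nabla\Phi(y))\ (x\ne y),\quad H_\Phi(x,x)=0.$$ Setting. Let $\gamma>0$. For $0<\varepsilon<1$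 let $f^0_\varepsilon\in L^1\cap L^\infty(\mathbb R^2\times\mathbb R^2)$ be nonnegative and compactly supported, and $\xi^0_\varepsilon,\eta^0_\varepsilon\in\mathbb R^2$, with $f^0_\varepsilon$ supported in $\{|x-\xi_\varepsilon^0|\ge\delta_\varepsilon\}$ for some $\delta_\varepsilon>0$. Put $\rho^0_\varepsilon=\int f^0_\varepsilon\,dv$ and assume $$\sup_{0<\varepsilon<1}\Big(\|f^0_\varepsilon\|_{L^1}+\int|x|^2\rho^0_\varepsilon\,dx+|\xi^0_\varepsilon|\Big)<\infty,\qquad \sup_{0<\varepsilon<1}\mathcal H(f^0_\varepsilon,\xi^0_\varepsilon,\eta^0_\varepsilon)<\infty,\qquad \varepsilon^2\|f^0_\varepsilon\|_{L^\infty}\xrightarrow[\varepsilon\to0]{}0,\qquad \sup_{0<\varepsilon<1}\|f^0_\varepsilon\|_{L^1}<1,$$ where $\mathcal H(f,\xi,\eta)=\frac12\iint|v|^2f\,dx\,dv+\frac12|\eta|^2-\frac12\iint\ln|x-y|\,\rho(x)\rho(y)\,dx\,dy-\gamma\int\ln|x-\xi|\,\rho(x)\,dx$ and $\rho=\int f\,dv$.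 Let $(f_\varepsilon,\xi_\varepsilon)$ be a global weak solution, with $f_\varepsilon\ge0$ in $L^\infty(\mathbb R_+,L^1\cap L^\infty)$, weakly continuous in time and compactly supported locally uniformly in time, of $$\begin{cases}\partial_tf_\varepsilon+\frac v\varepsilon\cdot\nabla_xf_\varepsilon+\Big(\frac{v^\perp}{\varepsilon^2}+\frac{E_\varepsilon}\varepsilon+\frac\gamma\varepsilon\frac{x-\xi_\varepsilon}{|x-\xi_\varepsilon|^2}\Big)\cdot\nabla_vf_\varepsilon=0,\qquad E_\varepsilon=\frac{x}{|x|^2}*\rho_\varepsilon,\quad\rho_\varepsilon=\int f_\varepsilon\,dv,\\ \dot\xi_\varepsilon=\frac{\eta_\varepsilon}\varepsilon,\qquad\dot\eta_\varepsilon=\gamma\Big(\frac{\eta_\varepsilon^\perp}{\varepsilon^2}+\frac{E_\varepsilon(t,\xi_\varepsilon)}\varepsilon\Big),\end{cases}$$ with initial data $(f^0_\varepsilon,\xi^0_\varepsilon,\eta^0_\varepsilon)$. Let $(\rho,\xi)$ be an accumulation point of $(\rho_\varepsilon,\xi_\varepsilon)$ as $\varepsilon\to0$: for some $\varepsilon_n\to0$,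 $\rho_{\varepsilon_n}\to\rho$ in $C_w(\mathbb R_+,\mathcal M_+(\mathbb R^2))$ and $\xi_{\varepsilon_n}\to\xi$ uniformly on $[0,T]$ for all $T>0$. A defect measure of $(\rho,\xi)$ is a $\nu\in[L^\infty(\mathbb R_+,\mathcal M(\mathbb R^2))]^4$ such that, for all $\Phi\in C_c^\infty(\mathbb R_+\times\mathbb R^2)$, $$\frac{d}{dt}\int\Phi\,d(\rho+\gamma\delta_\xi)=\int\partial_t\Phi\,d(\rho+\gamma\delta_\xi)+\mathcal H_{\Phi(t)}[\rho+\gamma\delta_\xi,\rho+\gamma\delta_\xi]+\int D\nabla^\perp\Phi:d\nu$$ in the sense of distributions in time on $(0,\infty)$. Theorem. Suppose that $(\rho,\xi)$ has a defect measure $\nu$ which vanishes, that $\rho\in L^\infty_{\rm loc}(\mathbb R_+,L^p(\mathbb R^2))$ for some $p\in(2,\infty]$, and that $\xi\in C^1(\mathbb R_+,\mathbb R^2)$. Then $(\rho,\xi)$ solves the vortex-wave system $$\begin{cases}\partial_t\rho+\Big(E^\perp+\gamma\frac{(x-\xi)^\perp}{|x-\xi|^2}\Big)\cdot\nabla\rho=0,\\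 \dot\xi(t)=E^\perp(t,\xi(t)),\end{cases}\qquad E=\frac{x}{|x|^2}*\rho.$$ Here the first equation, whose velocity $u=E^\perp+\gamma\frac{(x-\xi)^\perp}{|x-\xi|^2}$ is divergence free, is meant in the sense of distributions: the convolution defining $E(t,x)$ converges absolutely for all $t\ge0$ and $x\in\mathbb R^2$, $u(t)\in L^1(\rho(t))$ for all $t\ge0$, and for all $\Phi\in C_c^\infty(\mathbb R_+\times\mathbb R^2)$ $$\int_0^\infty\!\!\int(\partial_t\Phi+u\cdot\nabla\Phi)\,d\rho(t)\,dt+\int\Phi(0,x)\,d\rho(0)(x)=0,$$ where the time integrand is integrable on $(0,\infty)$. The second equation holds for all $t\ge0$. -/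

import Mathlib

open MeasureTheory Set Filter
open scoped Topology ENNReal ContDiff ZeroAtInfty

namespace VortexWave

noncomputable section

/-! ### The plane, the Coulomb field, measure-valued curves -/

/-- The Euclidean plane `ℝ²`. -/
abbrev Plane : Type := EuclideanSpace ℝ (Fin 2)

/-- `(x₁, x₂)^⊥ = (-x₂, x₁)`. -/
def perp (x : Plane) : Plane := !₂[-(x 1), x 0]

/-- The kernel `x / |x|²` (with value `0` at the origin). -/
def coulomb (x : Plane) : Plane := (‖x‖ ^ 2)⁻¹ • x

/-- The field `E = (x / |x|²) ∗ μ` generated by a measure `μ`. -/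
def field (μ : Measure Plane) (x : Plane) : Plane := ∫ y, coulomb (x - y) ∂μ

/-- `μ ∈ C_w(ℝ₊, M₊(ℝ²))`: the measures `μ t`, `t ≥ 0`, are finite, and `t ↦ ∫ φ dμ(t)` is
continuous on `[0, ∞)` for every continuous `φ` vanishing at infinity.
Only the times `t ≥ 0` matter. -/
structure WeaklyContinuous (μ : ℝ → Measure Plane) : Prop where
  finite : ∀ t, 0 ≤ t → IsFiniteMeasure (μ t)
  continuousOn : ∀ φ : C₀(Plane, ℝ), ContinuousOn (fun t => ∫ x, φ x ∂(μ t)) (Ici 0)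

/-- Convergence of `μ n` to `ρ` in `C_w(ℝ₊, M₊(ℝ²))`. -/
def TendstoWeakly (μ : ℕ → ℝ → Measure Plane) (ρ : ℝ → Measure Plane) : Prop :=
  ∀ T : ℝ, 0 < T → ∀ φ : C₀(Plane, ℝ),
    TendstoUniformlyOn (fun n t => ∫ x, φ x ∂(μ n t)) (fun t => ∫ x, φ x ∂(ρ t)) atTop (Icc 0 T)

/-- `ρ ∈ L^∞_loc(ℝ₊, L^p(ℝ²))`. -/
def LocallyBoundedInLp (p : ℝ≥0∞) (ρ : ℝ → Measure Plane) : Prop :=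
  ∀ T : ℝ, 0 < T → ∃ C : ℝ, ∀ᵐ t ∂(volume.restrict (Icc 0 T)),
    ρ t ≪ volume ∧
      eLpNorm (fun x => ((ρ t).rnDeriv volume x).toReal) p volume ≤ ENNReal.ofReal C

/-- `Φ ∈ C_c^∞(ℝ₊ × ℝ²)`, given as the restriction to `t ≥ 0` of a smooth compactly supported
function on `ℝ × ℝ²`. -/
structure IsTest (Φ : ℝ → Plane → ℝ) : Prop where
  smooth : ContDiff ℝ ∞ (fun z : ℝ × Plane => Φ z.1 z.2)
  compact : HasCompactSupport (fun z : ℝ × Plane => Φ z.1 z.2)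

/-! ### The Vlasov-Poisson system with a point charge and a large magnetic field -/

/-- The spatial density `x ↦ ∫ f(x, v) dv`. -/
def density (f : Plane × Plane → ℝ) (x : Plane) : ℝ := ∫ v, f (x, v)

/-- The spatial density of `f ≥ 0`, as a measure on the plane. -/
def densityMeasure (f : Plane × Plane → ℝ) : Measure Plane :=
  volume.withDensity (fun x => ENNReal.ofReal (density f x))

/-- The energy of the system plasma + charge. -/
def energy (γ : ℝ) (f : Plane × Plane → ℝ) (ξ η : Plane) : ℝ :=
  (1 / 2) * (∫ z : Plane × Plane, ‖z.2‖ ^ 2 * f z) + (1 / 2) * ‖η‖ ^ 2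
    - (1 / 2) * (∫ z : Plane × Plane, Real.log ‖z.1 - z.2‖ * (density f z.1 * density f z.2))
    - γ * ∫ x, Real.log ‖x - ξ‖ * density f x

/-- The assumptions on the initial data `(f⁰_ε, ξ⁰_ε, η⁰_ε)`, `0 < ε < 1`. -/
structure AdmissibleData (γ : ℝ) (f₀ : ℝ → Plane × Plane → ℝ) (ξ₀ η₀ : ℝ → Plane) : Prop where
  integrable : ∀ ε ∈ Ioo (0 : ℝ) 1, Integrable (f₀ ε) volume
  bounded : ∀ ε ∈ Ioo (0 : ℝ) 1, MemLp (f₀ ε) ∞ volume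
  nonneg : ∀ ε ∈ Ioo (0 : ℝ) 1, 0 ≤ᵐ[volume] f₀ ε
  compact : ∀ ε ∈ Ioo (0 : ℝ) 1, ∃ K : Set (Plane × Plane), IsCompact K ∧
    ∀ᵐ z ∂(volume : Measure (Plane × Plane)), z ∉ K → f₀ ε z = 0
  away : ∀ ε ∈ Ioo (0 : ℝ) 1, ∃ δ : ℝ, 0 < δ ∧
    ∀ᵐ z ∂(volume : Measure (Plane × Plane)), ‖z.1 - ξ₀ ε‖ < δ → f₀ ε z = 0
  moments : ∃ C : ℝ, ∀ ε ∈ Ioo (0 : ℝ) 1,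
    (∫ z, |f₀ ε z|) + (∫ x, ‖x‖ ^ 2 * density (f₀ ε) x) + ‖ξ₀ ε‖ ≤ C
  energy_le : ∃ C : ℝ, ∀ ε ∈ Ioo (0 : ℝ) 1, energy γ (f₀ ε) (ξ₀ ε) (η₀ ε) ≤ C
  sup_norm : Tendsto (fun ε => ε ^ 2 * (eLpNorm (f₀ ε) ∞ volume).toReal) (𝓝[>] 0) (𝓝 0)
  small_mass : ∃ c : ℝ, c < 1 ∧ ∀ ε ∈ Ioo (0 : ℝ) 1, ∫ z, |f₀ ε z| ≤ c

/-- `ψ ∈ C_c^∞(ℝ₊ × ℝ² × ℝ²)`. -/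
structure IsKineticTest (ψ : ℝ → Plane → Plane → ℝ) : Prop where
  smooth : ContDiff ℝ ∞ (fun z : ℝ × Plane × Plane => ψ z.1 z.2.1 z.2.2)
  compact : HasCompactSupport (fun z : ℝ × Plane × Plane => ψ z.1 z.2.1 z.2.2)

/-- The force `v^⊥/ε² + E_ε/ε + (γ/ε) (x - ξ_ε)/|x - ξ_ε|²`, for a density `f` and a charge
at `ξ`. -/
def force (γ ε : ℝ) (f : Plane × Plane → ℝ) (ξ x v : Plane) : Plane :=
  (ε ^ 2)⁻¹ • perp v + ε⁻¹ • field (densityMeasure f) x + (γ / ε) • coulomb (x - ξ)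

/-- Global weak solutions `(f, ξ)`, with `η = ε ξ'`, of the Vlasov-Poisson system with a point
charge, in the class `f ∈ L^∞(ℝ₊, L¹ ∩ L^∞)`, `f ≥ 0`, with compact support locally uniformly in
time, and weakly continuous in time. The force is divergence free in `v`, so that the transport
equation may be tested against `C_c^∞` functions. -/
structure IsKineticSolution (γ ε : ℝ) (f₀ : Plane × Plane → ℝ) (ξ₀ η₀ : Plane)
    (f : ℝ → Plane × Plane → ℝ) (ξ η : ℝ → Plane) : Prop where
  nonneg : ∀ t, 0 ≤ t → 0 ≤ᵐ[volume] f t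
  integrable : ∀ t, 0 ≤ t → Integrable (f t) volume
  bounded : ∃ C : ℝ, ∀ t, 0 ≤ t → ∫ z, |f t z| ≤ C ∧ ∀ᵐ z, |f t z| ≤ C
  compact : ∀ T : ℝ, ∃ K : Set (Plane × Plane), IsCompact K ∧
    ∀ t ∈ Icc 0 T, ∀ᵐ z ∂(volume : Measure (Plane × Plane)), z ∉ K → f t z = 0
  continuous : ∀ φ : C₀(Plane × Plane, ℝ), ContinuousOn (fun t => ∫ z, φ z * f t z) (Ici 0)
  initial : f 0 =ᵐ[volume] f₀
  weak : ∀ ψ : ℝ → Plane → Plane → ℝ, IsKineticTest ψ →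
    (∫ t in Ioi (0 : ℝ), ∫ z : Plane × Plane,
        (deriv (fun s => ψ s z.1 z.2) t
          + inner ℝ (ε⁻¹ • z.2) (gradient (fun x => ψ t x z.2) z.1)
          + inner ℝ (force γ ε (f t) (ξ t) z.1 z.2) (gradient (fun v => ψ t z.1 v) z.2)) * f t z)
      + ∫ z : Plane × Plane, ψ 0 z.1 z.2 * f₀ z = 0
  position_initial : ξ 0 = ξ₀
  velocity_initial : η 0 = η₀
  position : ∀ t, 0 ≤ t → HasDerivWithinAt ξ (ε⁻¹ • η t) (Ici 0) t
  velocity : ∀ t, 0 ≤ t → HasDerivWithinAt η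
    (γ • ((ε ^ 2)⁻¹ • perp (η t) + ε⁻¹ • field (densityMeasure (f t)) (ξ t))) (Ici 0) t

/-- `(ρ, ξ)` is an accumulation point, as `ε → 0`, of the densities and charge positions
`(ρ_ε, ξ_ε)`: along some sequence `ε_n → 0`, the densities converge in `C_w(ℝ₊, M₊(ℝ²))` and the
positions converge uniformly on bounded time intervals. -/
def IsAccumulationPoint (f : ℝ → ℝ → Plane × Plane → ℝ) (ξε : ℝ → ℝ → Plane)
    (ρ : ℝ → Measure Plane) (ξ : ℝ → Plane) : Prop :=
  WeaklyContinuous ρ ∧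
    ∃ e : ℕ → ℝ, (∀ n, e n ∈ Ioo (0 : ℝ) 1) ∧ Tendsto e atTop (𝓝 0) ∧
      TendstoWeakly (fun n t => densityMeasure (f (e n) t)) ρ ∧
      ∀ T : ℝ, 0 < T → TendstoUniformlyOn (fun n => ξε (e n)) ξ atTop (Icc 0 T)

/-! ### The Euler equation with a defect measure -/

/-- `H_Φ(x, y) = (x - y)^⊥/|x - y|² · (∇Φ(x) - ∇Φ(y))`, which is `0` on the diagonal. -/
def hKernel (Φ : Plane → ℝ) (x y : Plane) : ℝ :=
  inner ℝ (perp (coulomb (x - y))) (gradient Φ x - gradient Φ y)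

/-- `𝓗_Φ[ρ, μ] = ½ ∬ H_Φ(x, y) dρ(x) dμ(y)`. -/
def hForm (Φ : Plane → ℝ) (ρ μ : Measure Plane) : ℝ :=
  (1 / 2) * ∫ z : Plane × Plane, hKernel Φ z.1 z.2 ∂(ρ.prod μ)

/-- The total measure `ρ + γ δ_ξ`. -/
def totalMeasure (γ : ℝ) (ρ : Measure Plane) (ξ : Plane) : Measure Plane :=
  ρ + ENNReal.ofReal γ • Measure.dirac ξ

/-- The entry `(i, j)` of the matrix `D∇^⊥Φ`, i.e. `∂_j (∇^⊥Φ)_i`. -/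
def dGradPerp (Φ : Plane → ℝ) (i j : Fin 2) (x : Plane) : ℝ :=
  (fderiv ℝ (fun y => perp (gradient Φ y)) x (EuclideanSpace.single j 1)) i

/-- `ν ∈ [L^∞(ℝ₊, M(ℝ²))]⁴`. -/
structure BoundedMatrixMeasure (ν : ℝ → Fin 2 → Fin 2 → SignedMeasure Plane) : Prop where
  measurable : ∀ i j, ∀ φ : C₀(Plane, ℝ),
    AEStronglyMeasurable (fun t => ∫ᵛ x, φ x ∂•(ν t i j)) (volume.restrict (Ioi 0))
  bounded : ∃ C : ℝ, ∀ᵐ t ∂(volume.restrict (Ioi (0 : ℝ))), ∀ i j,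
    (ν t i j).totalVariation univ ≤ ENNReal.ofReal C

/-- `ν` is a defect measure of `(ρ, ξ)`: for every test function `Φ`,
`d/dt ∫ Φ d(ρ + γ δ_ξ) = ∫ ∂_tΦ d(ρ + γ δ_ξ) + 𝓗_Φ[ρ + γ δ_ξ, ρ + γ δ_ξ] + ∫ D∇^⊥Φ : dν`
in the sense of distributions on `(0, ∞)`. -/
structure IsDefectMeasure (γ : ℝ) (ρ : ℝ → Measure Plane) (ξ : ℝ → Plane)
    (ν : ℝ → Fin 2 → Fin 2 → SignedMeasure Plane) : Prop where
  bounded : BoundedMatrixMeasure ν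
  equation : ∀ Φ : ℝ → Plane → ℝ, IsTest Φ →
    ∀ θ : ℝ → ℝ, ContDiff ℝ ∞ θ → HasCompactSupport θ → tsupport θ ⊆ Ioi 0 →
      -(∫ t in Ioi (0 : ℝ), deriv θ t * ∫ x, Φ t x ∂(totalMeasure γ (ρ t) (ξ t)))
        = ∫ t in Ioi (0 : ℝ), θ t *
            ((∫ x, deriv (fun s => Φ s x) t ∂(totalMeasure γ (ρ t) (ξ t)))
              + hForm (Φ t) (totalMeasure γ (ρ t) (ξ t)) (totalMeasure γ (ρ t) (ξ t))
              + ∑ i, ∑ j, ∫ᵛ x, dGradPerp (Φ t) i j x ∂•(ν t i j))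

/-! ### The vortex-wave system -/

/-- The velocity `E^⊥ + γ (x - ξ)^⊥/|x - ξ|²` with `E = (x/|x|²) ∗ ρ`. -/
def velocity (γ : ℝ) (ρ : Measure Plane) (ξ x : Plane) : Plane :=
  perp (field ρ x) + γ • perp (coulomb (x - ξ))

/-- `(ρ, ξ)` solves the vortex-wave system. The (divergence free) velocity is well defined and
integrable with respect to `ρ`; the transport equation holds in the sense of distributions on
`ℝ₊ × ℝ²`, including the initial time; the charge follows the field `E^⊥` at all times. -/
structure IsVortexWaveSolution (γ : ℝ) (ρ : ℝ → Measure Plane) (ξ : ℝ → Plane) : Prop where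
  field_integrable : ∀ t, 0 ≤ t → ∀ x, Integrable (fun y => coulomb (x - y)) (ρ t)
  velocity_integrable : ∀ t, 0 ≤ t → Integrable (velocity γ (ρ t) (ξ t)) (ρ t)
  flux_integrable : ∀ Φ : ℝ → Plane → ℝ, IsTest Φ →
    IntegrableOn (fun t => ∫ x, (deriv (fun s => Φ s x) t
      + inner ℝ (velocity γ (ρ t) (ξ t) x) (gradient (Φ t) x)) ∂(ρ t)) (Ioi 0)
  transport : ∀ Φ : ℝ → Plane → ℝ, IsTest Φ →
    (∫ t in Ioi (0 : ℝ), ∫ x, (deriv (fun s => Φ s x) t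
        + inner ℝ (velocity γ (ρ t) (ξ t) x) (gradient (Φ t) x)) ∂(ρ t))
      + ∫ x, Φ 0 x ∂(ρ 0) = 0
  charge : ∀ t, 0 ≤ t → HasDerivWithinAt ξ (perp (field (ρ t) (ξ t))) (Ici 0) t

end

end VortexWave

namespace VortexWave

noncomputable section

/-! ### The rotation and the regularized kernel -/

/-! Everything rests on one consequence of `ρ ∈ L^∞_loc(L^p)` with `p > 2`. The kernel `1/|z|` lies
locally in `L^q` for the conjugate exponent `q < 2`, so by Hölder the field created at any point by
the mass of `ρ(t)` within distance `δ` tends to `0` with `δ`, uniformly in space and locally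
uniformly in time. The `L^p` bound holds only for almost every time; weak continuity, tested with
`C₀` minorants of the kernel, and Fatou's lemma carry the estimate to every time
(`exists_lintegral_nearKernel_le`). Hence singular integrals against `ρ(t)` inherit the weak
continuity of `ρ` (`WeaklyContinuous.tendsto_integral_coulomb`), and the field is bounded and
continuous up to `t = 0`.

With this integrability the symmetrized form `𝓗_Φ` unfolds, by oddness of the kernel, into the
transport term of the field of `ρ + γδ_ξ` (`hForm_self`). The charge exerts no force on itself,
because the kernel is `0` at the origin. A vanishing defect measure thus gives one equation for the
sum of plasma and charge. As `ξ` is `C¹`, the chain rule along `(t, ξ(t))` turns it into transport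
of `ρ` with a source on the trajectory (`integral_flux_eq`): `∫ flux + ∫ Φ(0) dρ(0) = γ ∫ ∇Φ(t, ξ) ·
(ξ' - E^⊥(t, ξ)) dt`.

The two equations separate because `ρ` cannot carry such a source. Suppose `a = ξ' - E^⊥(ξ)` is
nonzero at some `t₀ > 0`, and take test functions at scale `δ` about `(t₀, ξ(t₀))`, with derivatives
of order one and gradient along `a`. The right side is at least a constant times `δ`. The left side
is `o(δ)`: the time window has length `2δ`, and in it both the mass of `ρ` near the charge and the
field of the charge integrated against `ρ` are small (`abs_flux_le`). So `ξ' = E^⊥(ξ)` for `t > 0`,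
and by continuity at `0`; the source then vanishes, leaving the transport equation with its initial
value. -/

theorem norm_perp (x : Plane) : ‖perp x‖ = ‖x‖ := by
  simp [EuclideanSpace.norm_eq, perp, Fin.sum_univ_two, add_comm]

/-- The rotation `perp` as a linear isometry. -/
def perpIso : Plane →ₗᵢ[ℝ] Plane where
  toFun := perp
  map_add' x y := by
    ext i; fin_cases i <;> simp [perp]; ring
  map_smul' c x := by
    ext i; fin_cases i <;> simp [perp]
  norm_map' := norm_perp

theorem perp_add (x y : Plane) : perp (x + y) = perp x + perp y := perpIso.map_add x y

theorem perp_smul (c : ℝ) (x : Plane) : perp (c • x) = c • perp x := perpIso.map_smul c x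

theorem perp_neg (x : Plane) : perp (-x) = -perp x := perpIso.map_neg x

theorem continuous_perp : Continuous perp := perpIso.continuous

theorem inner_perp_left (x y : Plane) : inner ℝ (perp x) y = -inner ℝ x (perp y) := by
  simp [perp, PiLp.inner_apply, Fin.sum_univ_two]

theorem perp_integral {α : Type*} [MeasurableSpace α] {μ : Measure α} (f : α → Plane) :
    perp (∫ a, f a ∂μ) = ∫ a, perp (f a) ∂μ :=
  (perpIso.integral_comp_comm f).symm

theorem norm_coulomb (x : Plane) : ‖coulomb x‖ = ‖x‖⁻¹ := by
  rcases eq_or_ne x 0 with rfl | hx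
  · simp [coulomb]
  · have : ‖x‖ ≠ 0 := norm_ne_zero_iff.2 hx
    rw [coulomb, norm_smul, norm_inv, norm_pow, norm_norm]
    field_simp

theorem coulomb_neg (x : Plane) : coulomb (-x) = -coulomb x := by
  simp [coulomb]

theorem coulomb_zero : coulomb 0 = 0 := by simp [coulomb]

theorem measurable_coulomb : Measurable coulomb :=
  ((measurable_norm.pow_const 2).inv).smul measurable_id

/-- The Coulomb kernel regularized at scale `δ`. -/
def coulombReg (δ : ℝ) (z : Plane) : Plane := ((max ‖z‖ δ) ^ 2)⁻¹ • z

theorem continuous_coulombReg {δ : ℝ} (hδ : 0 < δ) : Continuous (coulombReg δ) := by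
  refine Continuous.smul (Continuous.inv₀ ((continuous_norm.max continuous_const).pow 2)
    fun z => ?_) continuous_id
  exact pow_ne_zero _ (lt_max_of_lt_right hδ).ne'

theorem norm_coulombReg_le (δ : ℝ) (z : Plane) : ‖coulombReg δ z‖ ≤ ‖z‖⁻¹ := by
  rcases eq_or_ne z 0 with rfl | hz
  · simp [coulombReg]
  · have h0 : 0 < ‖z‖ := norm_pos_iff.2 hz
    rw [← norm_coulomb, coulombReg, coulomb, norm_smul, norm_smul]
    gcongr ?_ * _
    rw [norm_inv, norm_inv, norm_pow, norm_pow, norm_norm, Real.norm_of_nonneg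
      (h0.le.trans (le_max_left _ _))]
    gcongr
    exact le_max_left _ _

theorem tendsto_coulombReg (δ : ℝ) : Tendsto (coulombReg δ) (cocompact Plane) (𝓝 0) :=
  squeeze_zero_norm (norm_coulombReg_le δ)
    (tendsto_inv_atTop_zero.comp tendsto_norm_cocompact_atTop)

theorem uniformContinuous_coulombReg {δ : ℝ} (hδ : 0 < δ) : UniformContinuous (coulombReg δ) :=
  (continuous_coulombReg hδ).uniformContinuous_of_tendsto_cocompact (tendsto_coulombReg δ)

theorem norm_coulombReg_le_inv {δ : ℝ} (hδ : 0 < δ) (z : Plane) : ‖coulombReg δ z‖ ≤ δ⁻¹ := by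
  have h1 : 0 < max ‖z‖ δ := lt_max_of_lt_right hδ
  calc ‖coulombReg δ z‖ = ((max ‖z‖ δ) ^ 2)⁻¹ * ‖z‖ := by
        rw [coulombReg, norm_smul, norm_inv, norm_pow, Real.norm_of_nonneg h1.le]
    _ ≤ ((max ‖z‖ δ) ^ 2)⁻¹ * max ‖z‖ δ := by gcongr; exact le_max_left _ _
    _ = (max ‖z‖ δ)⁻¹ := by field_simp
    _ ≤ δ⁻¹ := by gcongr; exact le_max_right _ _

/-- The modulus of the Coulomb kernel inside the ball of radius `δ`. -/
def nearKernel (δ : ℝ) (z : Plane) : ℝ := (Metric.ball (0 : Plane) δ).indicator (fun z => ‖z‖⁻¹) z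

theorem nearKernel_nonneg (δ : ℝ) (z : Plane) : 0 ≤ nearKernel δ z :=
  indicator_nonneg (fun _ _ => by positivity) z

theorem nearKernel_of_lt {δ : ℝ} {z : Plane} (h : ‖z‖ < δ) : nearKernel δ z = ‖z‖⁻¹ :=
  indicator_of_mem (by simpa using h) _

theorem nearKernel_of_le {δ : ℝ} {z : Plane} (h : δ ≤ ‖z‖) : nearKernel δ z = 0 :=
  indicator_of_notMem (by simpa using h) _

theorem measurable_nearKernel (δ : ℝ) : Measurable (nearKernel δ) :=
  (measurable_norm.inv).indicator measurableSet_ball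

/-- The kernels agree for `|z| ≥ δ`; inside the ball the regularization only lowers the factor
`|z|⁻²` to `δ⁻²`, so the difference stays below the full kernel. -/
theorem norm_coulomb_sub_coulombReg_le {δ : ℝ} (hδ : 0 < δ) (z : Plane) :
    ‖coulomb z - coulombReg δ z‖ ≤ nearKernel δ z := by
  rcases le_or_gt δ ‖z‖ with h | h
  · rw [nearKernel_of_le h, coulombReg, coulomb, max_eq_left h]; simp
  · rcases eq_or_ne z 0 with rfl | hz
    · simpa [coulomb, coulombReg] using nearKernel_nonneg δ 0
    have h0 : 0 < ‖z‖ := norm_pos_iff.2 hz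
    rw [nearKernel_of_lt h, ← norm_coulomb, coulombReg, coulomb, ← sub_smul, norm_smul, norm_smul,
      max_eq_right h.le]
    gcongr ?_ * _
    have : (δ ^ 2)⁻¹ ≤ (‖z‖ ^ 2)⁻¹ := by gcongr
    rw [Real.norm_of_nonneg (sub_nonneg.2 this), Real.norm_of_nonneg (by positivity)]
    have : 0 < (δ ^ 2)⁻¹ := by positivity
    linarith

theorem norm_coulomb_le (z : Plane) {δ : ℝ} (hδ : 0 < δ) :
    ‖coulomb z‖ ≤ nearKernel δ z + δ⁻¹ := by
  rw [norm_coulomb]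
  rcases le_or_gt δ ‖z‖ with h | h
  · rw [nearKernel_of_le h, zero_add]; gcongr
  · rw [nearKernel_of_lt h]; have : 0 < δ⁻¹ := by positivity
    linarith

/-! ### Weakly continuous curves of measures -/

/-- Integration against a finite measure, as a functional on `C₀`. -/
def integralC₀ (μ : Measure Plane) [IsFiniteMeasure μ] : C₀(Plane, ℝ) →L[ℝ] ℝ :=
  LinearMap.mkContinuous
    { toFun := fun φ => ∫ x, φ x ∂μ
      map_add' := fun φ ψ => by
        simp only [ZeroAtInftyContinuousMap.coe_add, Pi.add_apply]
        exact integral_add (φ.toBCF.integrable μ) (ψ.toBCF.integrable μ)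
      map_smul' := fun c φ => by
        simp only [ZeroAtInftyContinuousMap.coe_smul, Pi.smul_apply, RingHom.id_apply]
        exact integral_smul c _ }
    (μ.real univ) fun φ => by
      have : ‖∫ x, φ x ∂μ‖ ≤ ‖φ‖ * μ.real univ :=
        norm_integral_le_of_norm_le_const (Eventually.of_forall fun x => by
          rw [← ZeroAtInftyContinuousMap.norm_toBCF_eq_norm]
          exact φ.toBCF.norm_coe_le_norm x)
      rw [mul_comm]; exact this

/-- Banach–Steinhaus on `C₀`: continuity on the compact interval bounds each orbit, hence the norms
of the functionals. Cutoffs equal to `1` on larger and larger balls recover the mass from the norm.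
-/
theorem WeaklyContinuous.exists_mass_le {ρ : ℝ → Measure Plane} (hρ : WeaklyContinuous ρ) (T : ℝ) :
    ∃ M : ℝ, 0 ≤ M ∧ ∀ t ∈ Icc 0 T, (ρ t).real univ ≤ M := by
  have hfin : ∀ t : Icc 0 T, IsFiniteMeasure (ρ t) := fun t => hρ.finite t t.2.1
  obtain ⟨M, hM⟩ := banach_steinhaus (g := fun t : Icc 0 T => integralC₀ (ρ t)) fun φ => by
    obtain ⟨C, hC⟩ := isCompact_Icc.exists_bound_of_continuousOn
      ((hρ.continuousOn φ).mono (Icc_subset_Ici_self : Icc 0 T ⊆ Ici 0))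
    exact ⟨C, fun t => hC t t.2⟩
  refine ⟨max M 0, le_max_right _ _, fun t ht => le_max_of_le_left ?_⟩
  have := hfin ⟨t, ht⟩
  have hball : Tendsto (fun n : ℕ => (ρ t).real (Metric.closedBall 0 n)) atTop
      (𝓝 ((ρ t).real univ)) := by
    rw [← Metric.iUnion_closedBall_nat (0 : Plane)]
    exact (ENNReal.tendsto_toReal (measure_ne_top _ _)).comp (tendsto_measure_iUnion_atTop
      fun m n h => Metric.closedBall_subset_closedBall (by exact_mod_cast h))
  refine le_of_tendsto' hball fun n => ?_
  obtain ⟨φ, h1, -, hc, h01⟩ := exists_continuous_one_zero_of_isCompact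
    (isCompact_closedBall (0 : Plane) n) isClosed_empty (disjoint_empty _)
  let ψ : C₀(Plane, ℝ) := ⟨φ, hc.is_zero_at_infty⟩
  have hψ : ‖ψ‖ ≤ 1 := by
    rw [← ZeroAtInftyContinuousMap.norm_toBCF_eq_norm]
    refine (BoundedContinuousFunction.norm_le zero_le_one).2 fun x => ?_
    have := h01 x
    exact abs_le.2 ⟨neg_one_lt_zero.le.trans this.1, this.2⟩
  calc (ρ t).real (Metric.closedBall 0 n)
      = ∫ x, (Metric.closedBall (0 : Plane) n).indicator 1 x ∂(ρ t) :=
        (integral_indicator_one Metric.isClosed_closedBall.measurableSet).symm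
    _ ≤ ∫ x, ψ x ∂(ρ t) := by
        refine integral_mono ((integrable_const (1 : ℝ)).indicator
          Metric.isClosed_closedBall.measurableSet) (ψ.toBCF.integrable _) fun x => ?_
        refine indicator_le' (fun x hx => (h1 hx).ge) (fun x _ => (h01 x).1) x
    _ ≤ ‖integralC₀ (ρ t) ψ‖ := le_abs_self _
    _ ≤ M * 1 := ((integralC₀ (ρ t)).le_opNorm ψ).trans
        (mul_le_mul (hM ⟨t, ht⟩) hψ (norm_nonneg _) ((norm_nonneg _).trans (hM ⟨t, ht⟩)))
    _ = M := mul_one _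

/-- Measure and integrand may vary together: the uniform error of the integrand is multiplied by a
locally bounded mass, and weak continuity handles the fixed limit integrand. -/
theorem WeaklyContinuous.tendsto_integral {ρ : ℝ → Measure Plane} (hρ : WeaklyContinuous ρ)
    {ι : Type*} {l : Filter ι} {τ : ι → ℝ} {t : ℝ} (ht : 0 ≤ t) (hτ : Tendsto τ l (𝓝[Ici 0] t))
    {G : ι → Plane → ℝ} {G₀ : Plane → ℝ} (hG₀ : Continuous G₀)
    (hG₀' : Tendsto G₀ (cocompact Plane) (𝓝 0)) (hG : TendstoUniformly G G₀ l)
    (hint : ∀ᶠ i in l, Integrable (G i) (ρ (τ i))) :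
    Tendsto (fun i => ∫ x, G i x ∂(ρ (τ i))) l (𝓝 (∫ x, G₀ x ∂(ρ t))) := by
  let φ : C₀(Plane, ℝ) := ⟨⟨G₀, hG₀⟩, hG₀'⟩
  obtain ⟨M, hM0, hM⟩ := hρ.exists_mass_le (t + 1)
  have h1 : Tendsto (fun i => ∫ x, G₀ x ∂(ρ (τ i))) l (𝓝 (∫ x, G₀ x ∂(ρ t))) :=
    (hρ.continuousOn φ t ht).tendsto.comp hτ
  have hτ' : ∀ᶠ i in l, τ i ∈ Icc 0 (t + 1) := by
    refine hτ.eventually ?_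
    filter_upwards [self_mem_nhdsWithin, mem_nhdsWithin_of_mem_nhds
      (Iic_mem_nhds (lt_add_one t))] with s h1 h2 using ⟨h1, h2⟩
  have h2 : Tendsto (fun i => ∫ x, G i x ∂(ρ (τ i)) - ∫ x, G₀ x ∂(ρ (τ i))) l (𝓝 0) := by
    rw [Metric.tendsto_nhds]
    intro ε hε
    have hε' : 0 < ε / (M + 1) := by positivity
    filter_upwards [Metric.tendstoUniformly_iff.1 hG _ hε', hint, hτ'] with i hi hii hti
    have := hρ.finite _ hti.1
    have hφi : Integrable G₀ (ρ (τ i)) := φ.toBCF.integrable _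
    rw [dist_zero_right, ← integral_sub hii hφi]
    calc ‖∫ x, (G i x - G₀ x) ∂(ρ (τ i))‖ ≤ ε / (M + 1) * (ρ (τ i)).real univ :=
          norm_integral_le_of_norm_le_const (Eventually.of_forall fun x => by
            rw [← dist_eq_norm, dist_comm]; exact (hi x).le)
      _ ≤ ε / (M + 1) * M := by gcongr; exact hM _ hti
      _ < ε := by rw [div_mul_eq_mul_div, div_lt_iff₀ (by positivity)]; nlinarith
  simpa using h2.add h1

/-! ### The near field of a density in `L^p`, `p > 2` -/

theorem memLp_nearKernel {q : ℝ≥0∞} (hq1 : 1 ≤ q) (hq2 : q < 2) :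
    MemLp (nearKernel 1) q volume := by
  have hq0 : q ≠ 0 := (zero_lt_one.trans_le hq1).ne'
  have hqt : q ≠ ⊤ := hq2.ne_top
  have hr : q.toReal < 2 := by
    simpa using (ENNReal.toReal_lt_toReal hqt (by simp)).2 hq2
  have hr0 : q.toReal ≠ 0 := (ENNReal.toReal_pos hq0 hqt).ne'
  rw [← integrable_norm_rpow_iff (measurable_nearKernel 1).aestronglyMeasurable hq0 hqt]
  have heq : (fun x : Plane => ‖nearKernel 1 x‖ ^ q.toReal)
      = (Metric.ball (0 : Plane) 1).indicator (fun x => ‖x‖⁻¹ ^ q.toReal) := by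
    ext x
    rw [Real.norm_of_nonneg (nearKernel_nonneg _ _)]
    by_cases hx : ‖x‖ < 1
    · rw [nearKernel_of_lt hx, indicator_of_mem (by simpa using hx)]
    · rw [nearKernel_of_le (not_lt.1 hx), indicator_of_notMem (by simpa using hx),
        Real.zero_rpow hr0]
  rw [heq, integrable_indicator_iff measurableSet_ball,
    integrableOn_fun_norm_addHaar volume (f := fun y => y⁻¹ ^ q.toReal)]
  -- The radial integrand in dimension two, integrable at `0` since `1 - q > -1`; this is where `q <
  -- 2` enters.
  have h1 : IntegrableOn (fun y : ℝ => y ^ (1 - q.toReal)) (Ioo 0 1) := by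
    rw [← integrableOn_Ioc_iff_integrableOn_Ioo,
      ← intervalIntegrable_iff_integrableOn_Ioc_of_le zero_le_one]
    exact intervalIntegral.intervalIntegrable_rpow' (by linarith)
  refine h1.congr_fun (fun y hy => ?_) measurableSet_Ioo
  simp only [finrank_euclideanSpace, Fintype.card_fin, smul_eq_mul]
  rw [Real.rpow_sub hy.1, Real.rpow_one, Real.inv_rpow hy.1.le]
  simp [div_eq_mul_inv]

theorem nearKernel_eq_indicator {δ : ℝ} (hδ : δ ≤ 1) :
    nearKernel δ = (Metric.ball (0 : Plane) δ).indicator (nearKernel 1) := by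
  ext z
  by_cases hz : ‖z‖ < δ
  · rw [indicator_of_mem (by simpa using hz), nearKernel_of_lt hz,
      nearKernel_of_lt (hz.trans_le hδ)]
  · rw [indicator_of_notMem (by simpa using hz), nearKernel_of_le (not_lt.1 hz)]

/-- Absolute continuity of the `L^q` norm: the near kernel at scale `δ ≤ 1` restricts a fixed `L^q`
function to a ball whose volume tends to `0`. -/
theorem exists_eLpNorm_nearKernel_le {q : ℝ≥0∞} (hq1 : 1 ≤ q) (hq2 : q < 2) {ε : ℝ} (hε : 0 < ε) :
    ∃ δ : ℝ, 0 < δ ∧ eLpNorm (nearKernel δ) q volume ≤ ENNReal.ofReal ε := by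
  obtain ⟨κ, hκ, h⟩ := (memLp_nearKernel hq1 hq2).eLpNorm_indicator_le hq1 hq2.ne_top hε
  have hlim : Tendsto (fun δ : ℝ => volume (Metric.ball (0 : Plane) δ)) (𝓝[>] 0) (𝓝 0) := by
    have h2 : ∀ᶠ δ : ℝ in 𝓝[>] 0, volume (Metric.ball (0 : Plane) δ)
        = ENNReal.ofReal (δ ^ 2) * volume (Metric.ball (0 : Plane) 1) := by
      filter_upwards [self_mem_nhdsWithin] with δ hδ
      rw [Measure.addHaar_ball volume (0 : Plane) (le_of_lt hδ)]
      simp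
    rw [tendsto_congr' h2]
    have h3 : Tendsto (fun δ : ℝ => ENNReal.ofReal (δ ^ 2)) (𝓝[>] 0) (𝓝 0) := by
      have : Tendsto (fun δ : ℝ => δ ^ 2) (𝓝[>] 0) (𝓝 0) :=
        ((continuous_pow 2).tendsto' 0 0 (by simp)).mono_left nhdsWithin_le_nhds
      simpa using ENNReal.tendsto_ofReal this
    simpa using ENNReal.Tendsto.mul_const (b := volume (Metric.ball (0 : Plane) 1)) h3
      (Or.inr measure_ball_lt_top.ne)
  have hκ' : (0 : ℝ≥0∞) < ENNReal.ofReal κ := ENNReal.ofReal_pos.2 hκ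
  obtain ⟨δ, h1, h2, h3⟩ := ((hlim.eventually (gt_mem_nhds hκ')).and
    (Ioo_mem_nhdsGT (zero_lt_one (α := ℝ)))).exists
  refine ⟨δ, h2, ?_⟩
  rw [nearKernel_eq_indicator h3.le]
  exact h _ measurableSet_ball h1.le

/-- Hölder's inequality for an absolutely continuous measure. -/
theorem lintegral_enorm_le_eLpNorm_mul {μ : Measure Plane} [IsFiniteMeasure μ] (hμ : μ ≪ volume)
    {p q : ℝ≥0∞} [p.HolderConjugate q] {k : Plane → ℝ} (hk : Measurable k) :
    ∫⁻ x, ‖k x‖ₑ ∂μ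
      ≤ eLpNorm (fun x => (μ.rnDeriv volume x).toReal) p volume * eLpNorm k q volume := by
  have hr : Measurable (fun x => (μ.rnDeriv volume x).toReal) :=
    (Measure.measurable_rnDeriv _ _).ennreal_toReal
  refine le_trans (le_of_eq ?_) (eLpNorm_smul_le_mul_eLpNorm (r := 1) hk.aestronglyMeasurable
    hr.aestronglyMeasurable)
  rw [eLpNorm_one_eq_lintegral_enorm, ← lintegral_rnDeriv_mul hμ hk.enorm.aemeasurable]
  refine lintegral_congr_ae ?_
  filter_upwards [Measure.rnDeriv_lt_top μ volume] with x hx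
  rw [Pi.smul_apply', enorm_smul, Real.enorm_of_nonneg ENNReal.toReal_nonneg,
    ENNReal.ofReal_toReal hx.ne]

theorem WeaklyContinuous.integral_le_of_ae {ρ : ℝ → Measure Plane} (hρ : WeaklyContinuous ρ)
    {T : ℝ} (hT : 0 < T) {C : ℝ} (φ : C₀(Plane, ℝ))
    (h : ∀ᵐ t ∂(volume.restrict (Icc 0 T)), ∫ x, φ x ∂(ρ t) ≤ C) {t : ℝ} (ht : t ∈ Icc 0 T) :
    ∫ x, φ x ∂(ρ t) ≤ C := by
  have hc : ContinuousOn (fun t => ∫ x, φ x ∂(ρ t)) (Icc 0 T) :=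
    (hρ.continuousOn φ).mono Icc_subset_Ici_self
  -- Taking the maximum with `C` turns an inequality a.e. into an equality a.e. of continuous
  -- functions, which then holds everywhere on the interval.
  have := Measure.eqOn_Icc_of_ae_eq volume hT.ne
    (f := fun t => max (∫ x, φ x ∂(ρ t)) C) (g := fun _ => C)
    (h.mono fun t ht => max_eq_right ht) (hc.sup continuousOn_const) continuousOn_const ht
  exact max_eq_right_iff.1 this

/-- The near field of `ρ(t)` is small, uniformly in space and locally uniformly in time. -/
theorem exists_lintegral_nearKernel_le {ρ : ℝ → Measure Plane} (hρ : WeaklyContinuous ρ)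
    {p : ℝ≥0∞} (hp : 2 < p) (hL : LocallyBoundedInLp p ρ) (T : ℝ) {ε : ℝ} (hε : 0 < ε) :
    ∃ δ : ℝ, 0 < δ ∧ ∀ t ∈ Icc 0 T, ∀ x,
      ∫⁻ y, ENNReal.ofReal (nearKernel δ (x - y)) ∂(ρ t) ≤ ENNReal.ofReal ε := by
  wlog hT : 0 < T generalizing T
  · obtain ⟨δ, hδ, h⟩ := this 1 one_pos
    exact ⟨δ, hδ, fun t ht => h t ⟨ht.1, by linarith [ht.2]⟩⟩
  obtain ⟨C, hC⟩ := hL T hT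
  have hp1 : 1 ≤ p := le_trans (by norm_num) hp.le
  have hconj : p.HolderConjugate p.conjExponent := ENNReal.HolderConjugate.conjExponent hp1
  set q := p.conjExponent with hq
  have hq1 : 1 ≤ q := ENNReal.HolderConjugate.one_le q p
  have hq2 : q < 2 := by
    have h1 : 1 < p - 1 := by
      rw [lt_tsub_iff_right]; norm_num; exact hp
    have h2 : (p - 1)⁻¹ < 1 := ENNReal.inv_lt_one.2 h1
    calc q = 1 + (p - 1)⁻¹ := rfl
      _ < 1 + 1 := ENNReal.add_lt_add_left (by simp) h2
      _ = 2 := by norm_num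
  set C' : ℝ := max C 0 + 1 with hC'
  have hC'0 : 0 < C' := by positivity
  obtain ⟨δ, hδ, hδk⟩ := exists_eLpNorm_nearKernel_le hq1 hq2 (div_pos hε hC'0)
  refine ⟨δ / 2, half_pos hδ, fun t ht x => ?_⟩
  obtain ⟨c, hc1, hc0, -, hc01⟩ := exists_continuous_one_zero_of_isCompact
    (isCompact_closedBall (0 : Plane) (δ / 2)) (Metric.isOpen_ball (x := (0 : Plane)) (ε := δ)
      ).isClosed_compl (by
        rw [disjoint_compl_right_iff_subset]
        exact Metric.closedBall_subset_ball (by linarith))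
  -- Weak continuity sees only `C₀` functions. These lie below the near kernel at scale `δ`, and for
  -- large `m` they equal `1/|z|` at each `z ≠ 0` with `|z| < δ / 2`; this costs the factor `2` in
  -- the scale.
  let k : ℕ → Plane → ℝ := fun m z => c z * ‖coulombReg (1 / (m + 1)) z‖
  have hm : ∀ m : ℕ, (0 : ℝ) < 1 / (m + 1) := fun m => Nat.one_div_pos_of_nat
  have hkc : ∀ m, Continuous (k m) := fun m =>
    c.continuous.mul (continuous_coulombReg (hm m)).norm
  have hk0 : ∀ m z, 0 ≤ k m z := fun m z => mul_nonneg (hc01 z).1 (norm_nonneg _)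
  have hkle : ∀ m z, k m z ≤ ‖coulombReg (1 / (m + 1)) z‖ := fun m z =>
    mul_le_of_le_one_left (norm_nonneg _) (hc01 z).2
  have hknear : ∀ m z, k m z ≤ nearKernel δ z := fun m z => by
    by_cases hz : ‖z‖ < δ
    · rw [nearKernel_of_lt hz]; exact (hkle m z).trans (norm_coulombReg_le _ _)
    · have : c z = 0 := hc0 (by simpa using hz)
      simp [k, this, nearKernel_nonneg]
  have hkinf : ∀ m, Tendsto (fun y => k m (x - y)) (cocompact Plane) (𝓝 0) := fun m => by
    have h1 : Tendsto (k m) (cocompact Plane) (𝓝 0) :=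
      squeeze_zero (hk0 m) (hkle m) (by simpa using (tendsto_coulombReg _).norm)
    exact h1.comp (Homeomorph.subLeft x).isClosedEmbedding.tendsto_cocompact
  let φ : ℕ → C₀(Plane, ℝ) := fun m =>
    ⟨⟨fun y => k m (x - y), (hkc m).comp (continuous_const.sub continuous_id)⟩, hkinf m⟩
  have hφ0 : ∀ m y, 0 ≤ φ m y := fun m y => hk0 m _
  have hφc : ∀ m, Continuous fun y => φ m y := fun m =>
    (hkc m).comp (continuous_const.sub continuous_id)
  have hkL : ∀ m, eLpNorm (fun y => k m (x - y)) q volume ≤ ENNReal.ofReal (ε / C') := fun m => by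
    have h1 := eLpNorm_comp_measurePreserving (p := q) (hkc m).aestronglyMeasurable
      (Measure.measurePreserving_sub_left (volume : Measure Plane) x)
    calc eLpNorm (fun y => k m (x - y)) q volume = eLpNorm (k m) q volume := h1
      _ ≤ eLpNorm (nearKernel δ) q volume := eLpNorm_mono_real fun z => by
          rw [Real.norm_of_nonneg (hk0 m z)]; exact hknear m z
      _ ≤ _ := hδk
  have hle : ∀ m, ∀ s ∈ Icc 0 T, ∫ y, φ m y ∂(ρ s) ≤ ε := fun m s hs => by
    refine hρ.integral_le_of_ae hT (φ m) ?_ hs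
    filter_upwards [hC, ae_restrict_mem measurableSet_Icc] with s hs hsI
    have := hρ.finite s hsI.1
    have h1 := lintegral_enorm_le_eLpNorm_mul (p := p) (q := q) hs.1
      (hφc m).measurable
    rw [integral_eq_lintegral_of_nonneg_ae (Eventually.of_forall (hφ0 m))
      (hφc m).aestronglyMeasurable]
    refine ENNReal.toReal_le_of_le_ofReal hε.le ?_
    calc ∫⁻ y, ENNReal.ofReal (φ m y) ∂(ρ s) = ∫⁻ y, ‖φ m y‖ₑ ∂(ρ s) :=
          lintegral_congr fun y => (Real.enorm_of_nonneg (hk0 m _)).symm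
      _ ≤ ENNReal.ofReal C' * ENNReal.ofReal (ε / C') := by
          refine h1.trans (mul_le_mul' (hs.2.trans (ENNReal.ofReal_le_ofReal ?_)) (hkL m))
          linarith [le_max_left C 0]
      _ = ENNReal.ofReal ε := by
          rw [← ENNReal.ofReal_mul hC'0.le]; congr 1; field_simp
  have := hρ.finite t ht.1
  calc ∫⁻ y, ENNReal.ofReal (nearKernel (δ / 2) (x - y)) ∂(ρ t)
      ≤ ∫⁻ y, liminf (fun m => ENNReal.ofReal (φ m y)) atTop ∂(ρ t) := by
        refine lintegral_mono fun y => ?_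
        set z := x - y with hz
        rcases le_or_gt (δ / 2) ‖z‖ with h | h
        · simp [nearKernel_of_le h]
        rcases eq_or_ne z 0 with h0 | h0
        · simp [h0, nearKernel_of_lt (show ‖(0 : Plane)‖ < δ / 2 by simpa using half_pos hδ)]
        refine le_of_eq (Tendsto.liminf_eq ?_).symm
        refine tendsto_const_nhds.congr' ?_
        have hlim : Tendsto (fun m : ℕ => (1 : ℝ) / (m + 1)) atTop (𝓝 0) :=
          tendsto_one_div_add_atTop_nhds_zero_nat
        filter_upwards [hlim.eventually (gt_mem_nhds (norm_pos_iff.2 h0))] with m hm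
        congr 1
        have hcz : c z = 1 := hc1 (by simpa using h.le)
        change _ = c z * ‖coulombReg (1 / (m + 1)) z‖
        rw [nearKernel_of_lt h, hcz, one_mul, ← norm_coulomb, coulombReg, coulomb,
          max_eq_left hm.le]
    -- Fatou's lemma at the given time `t`, where no `L^p` bound is available.
    _ ≤ liminf (fun m => ∫⁻ y, ENNReal.ofReal (φ m y) ∂(ρ t)) atTop :=
        lintegral_liminf_le fun m => (hφc m).measurable.ennreal_ofReal
    _ ≤ liminf (fun _ : ℕ => ENNReal.ofReal ε) atTop := by
        refine liminf_le_liminf (Eventually.of_forall fun m => ?_)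
        have hi : Integrable (fun y => φ m y) (ρ t) := (φ m).toBCF.integrable _
        rw [← ofReal_integral_eq_lintegral_ofReal hi (Eventually.of_forall (hφ0 m))]
        exact ENNReal.ofReal_le_ofReal (hle m t ht)
    _ = ENNReal.ofReal ε := by simp

/-- `δ` is a scale at which the near field of `μ` is at most `ε`, at every point. -/
def NearFieldLE (μ : Measure Plane) (δ ε : ℝ) : Prop :=
  ∀ x, Integrable (fun y => nearKernel δ (x - y)) μ ∧ ∫ y, nearKernel δ (x - y) ∂μ ≤ ε

theorem exists_nearFieldLE {ρ : ℝ → Measure Plane} (hρ : WeaklyContinuous ρ)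
    {p : ℝ≥0∞} (hp : 2 < p) (hL : LocallyBoundedInLp p ρ) (T : ℝ) {ε : ℝ} (hε : 0 < ε) :
    ∃ δ : ℝ, 0 < δ ∧ ∀ t ∈ Icc 0 T, NearFieldLE (ρ t) δ ε := by
  obtain ⟨δ, hδ, h⟩ := exists_lintegral_nearKernel_le hρ hp hL T hε
  refine ⟨δ, hδ, fun t ht x => ?_⟩
  have hm : AEStronglyMeasurable (fun y => nearKernel δ (x - y)) (ρ t) :=
    ((measurable_nearKernel δ).comp (measurable_const.sub measurable_id)).aestronglyMeasurable
  have h0 : 0 ≤ᵐ[ρ t] fun y => nearKernel δ (x - y) :=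
    Eventually.of_forall fun y => nearKernel_nonneg _ _
  constructor
  · refine ⟨hm, ?_⟩
    rw [hasFiniteIntegral_iff_ofReal h0]
    exact (h t ht x).trans_lt ENNReal.ofReal_lt_top
  · rw [integral_eq_lintegral_of_nonneg_ae h0 hm]
    exact ENNReal.toReal_le_of_le_ofReal hε.le (h t ht x)

theorem NearFieldLE.integrable_coulomb {μ : Measure Plane} [IsFiniteMeasure μ] {δ ε : ℝ}
    (hδ : 0 < δ) (h : NearFieldLE μ δ ε) (x : Plane) :
    Integrable (fun y => coulomb (x - y)) μ :=
  ((h x).1.add (integrable_const δ⁻¹)).mono'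
    (measurable_coulomb.comp (measurable_const.sub measurable_id)).aestronglyMeasurable
    (Eventually.of_forall fun _ => norm_coulomb_le _ hδ)

theorem NearFieldLE.integral_norm_coulomb_le {μ : Measure Plane} [IsFiniteMeasure μ] {δ ε : ℝ}
    (hδ : 0 < δ) (h : NearFieldLE μ δ ε) (x : Plane) :
    ∫ y, ‖coulomb (x - y)‖ ∂μ ≤ ε + δ⁻¹ * μ.real univ := by
  calc ∫ y, ‖coulomb (x - y)‖ ∂μ ≤ ∫ y, (nearKernel δ (x - y) + δ⁻¹) ∂μ :=
        integral_mono (h.integrable_coulomb hδ x).norm ((h x).1.add (integrable_const _))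
          fun _ => norm_coulomb_le _ hδ
    _ = ∫ y, nearKernel δ (x - y) ∂μ + δ⁻¹ * μ.real univ := by
        rw [integral_add (h x).1 (integrable_const _), integral_const, smul_eq_mul, mul_comm]
    _ ≤ _ := by gcongr; exact (h x).2

/-! ### Continuity of the field -/

theorem nearKernel_neg (δ : ℝ) (z : Plane) : nearKernel δ (-z) = nearKernel δ z := by
  simp [nearKernel, indicator]

theorem NearFieldLE.integrable_inner_coulomb {μ : Measure Plane} [IsFiniteMeasure μ] {δ ε : ℝ}
    (hδ : 0 < δ) (h : NearFieldLE μ δ ε) (ζ : Plane) {V : Plane → Plane} (hV : Continuous V)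
    {B : ℝ} (hB : ∀ x, ‖V x‖ ≤ B) :
    Integrable (fun x => inner ℝ (coulomb (x - ζ)) (V x)) μ := by
  refine ((h.integrable_coulomb hδ ζ).norm.mul_const B).mono'
    ((measurable_coulomb.comp (measurable_id.sub measurable_const)).inner
      hV.measurable).aestronglyMeasurable (Eventually.of_forall fun x => ?_)
  rw [← norm_neg (coulomb (ζ - x)), ← coulomb_neg, neg_sub]
  exact (norm_inner_le_norm _ _).trans (by gcongr; exact hB x)

theorem integrable_inner_coulombReg {μ : Measure Plane} [IsFiniteMeasure μ] {δ : ℝ}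
    (hδ : 0 < δ) (ζ : Plane) {V : Plane → Plane} (hV : Continuous V)
    {B : ℝ} (hB : ∀ x, ‖V x‖ ≤ B) :
    Integrable (fun x => inner ℝ (coulombReg δ (x - ζ)) (V x)) μ := by
  refine (integrable_const (δ⁻¹ * B)).mono'
    (((continuous_coulombReg hδ).comp (continuous_id.sub continuous_const)).inner
      hV).aestronglyMeasurable (Eventually.of_forall fun x => ?_)
  refine (norm_inner_le_norm _ _).trans ?_
  gcongr
  · exact norm_coulombReg_le_inv hδ _
  · exact hB x

theorem NearFieldLE.abs_integral_sub_le {μ : Measure Plane} [IsFiniteMeasure μ] {δ ε : ℝ}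
    (hδ : 0 < δ) (h : NearFieldLE μ δ ε) (ζ : Plane) {V : Plane → Plane} (hV : Continuous V)
    {B : ℝ} (hB : ∀ x, ‖V x‖ ≤ B) :
    |∫ x, inner ℝ (coulomb (x - ζ)) (V x) ∂μ - ∫ x, inner ℝ (coulombReg δ (x - ζ)) (V x) ∂μ|
      ≤ B * ε := by
  have hB0 : 0 ≤ B := (norm_nonneg _).trans (hB 0)
  rw [← integral_sub (h.integrable_inner_coulomb hδ ζ hV hB)
    (integrable_inner_coulombReg hδ ζ hV hB), ← Real.norm_eq_abs]
  calc _ ≤ ∫ x, B * nearKernel δ (ζ - x) ∂μ := by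
        refine norm_integral_le_of_norm_le ((h ζ).1.const_mul B) (Eventually.of_forall fun x => ?_)
        rw [← inner_sub_left, ← nearKernel_neg, neg_sub, mul_comm]
        refine (norm_inner_le_norm _ _).trans ?_
        gcongr
        · exact nearKernel_nonneg _ _
        · exact norm_coulomb_sub_coulombReg_le hδ _
        · exact hB x
    _ ≤ B * ε := by
        rw [integral_const_mul]
        gcongr
        exact (h ζ).2

/-- The near field of `ρ(t)` vanishes as the scale tends to `0`, locally uniformly in time. -/
def NearFieldVanishes (ρ : ℝ → Measure Plane) : Prop :=
  ∀ T ε : ℝ, 0 < ε → ∃ δ : ℝ, 0 < δ ∧ ∀ t ∈ Icc 0 T, NearFieldLE (ρ t) δ ε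

/-- At a fixed scale the regularized kernel is uniformly continuous and vanishes at infinity, so
`WeaklyContinuous.tendsto_integral` applies. The error of regularization is small uniformly in time
and in the pole. Decay comes from the kernel, so `V₀` need only be bounded. -/
theorem WeaklyContinuous.tendsto_integral_coulomb {ρ : ℝ → Measure Plane}
    (hρ : WeaklyContinuous ρ) (hN : NearFieldVanishes ρ)
    {ι : Type*} {l : Filter ι} {τ : ι → ℝ} {t : ℝ} (ht : 0 ≤ t) (hτ : Tendsto τ l (𝓝[Ici 0] t))
    {ζ : ι → Plane} {ζ₀ : Plane} (hζ : Tendsto ζ l (𝓝 ζ₀))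
    {V : ι → Plane → Plane} {V₀ : Plane → Plane} (hV : TendstoUniformly V V₀ l)
    (hVc : ∀ i, Continuous (V i)) (hV₀c : Continuous V₀) {B : ℝ} (hB : ∀ x, ‖V₀ x‖ ≤ B) :
    Tendsto (fun i => ∫ x, inner ℝ (coulomb (x - ζ i)) (V i x) ∂(ρ (τ i))) l
      (𝓝 (∫ x, inner ℝ (coulomb (x - ζ₀)) (V₀ x) ∂(ρ t))) := by
  have hB0 : 0 ≤ B := (norm_nonneg _).trans (hB 0)
  have hVB : ∀ᶠ i in l, ∀ x, ‖V i x‖ ≤ B + 1 := by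
    filter_upwards [Metric.tendstoUniformly_iff.1 hV 1 one_pos] with i hi x
    have := hi x
    rw [dist_eq_norm] at this
    calc ‖V i x‖ = ‖V₀ x - (V₀ x - V i x)‖ := by simp
      _ ≤ ‖V₀ x‖ + ‖V₀ x - V i x‖ := norm_sub_le _ _
      _ ≤ B + 1 := by gcongr; exact hB x
  have hτ' : ∀ᶠ i in l, τ i ∈ Icc 0 (t + 1) := by
    refine hτ.eventually ?_
    filter_upwards [self_mem_nhdsWithin, mem_nhdsWithin_of_mem_nhds
      (Iic_mem_nhds (lt_add_one t))] with s h1 h2 using ⟨h1, h2⟩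
  rw [Metric.tendsto_nhds]
  intro ε hε
  -- Budget: `ε / 4` for regularizing at each of the times `τ i` and `t`, `ε / 2` for the
  -- convergence at fixed scale.
  obtain ⟨δ, hδ, hnear⟩ := hN (t + 1) (ε / 4 / (B + 1)) (by positivity)
  have hreg : Tendsto (fun i => ∫ x, inner ℝ (coulombReg δ (x - ζ i)) (V i x) ∂(ρ (τ i))) l
      (𝓝 (∫ x, inner ℝ (coulombReg δ (x - ζ₀)) (V₀ x) ∂(ρ t))) := by
    have hcont : Continuous fun x => coulombReg δ (x - ζ₀) :=
      (continuous_coulombReg hδ).comp (continuous_id.sub continuous_const)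
    refine hρ.tendsto_integral ht hτ (hcont.inner hV₀c) ?_ ?_ ?_
    · have h1 : Tendsto (fun x => coulombReg δ (x - ζ₀)) (cocompact Plane) (𝓝 0) :=
        (tendsto_coulombReg δ).comp
          (Homeomorph.subRight ζ₀).isClosedEmbedding.tendsto_cocompact
      have h2 : Tendsto (fun x => ‖coulombReg δ (x - ζ₀)‖ * B) (cocompact Plane) (𝓝 0) := by
        simpa using h1.norm.mul_const B
      refine squeeze_zero_norm (fun x => (norm_inner_le_norm _ _).trans ?_) h2
      gcongr; exact hB x
    · rw [Metric.tendstoUniformly_iff]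
      intro κ hκ
      obtain ⟨r, hr, hru⟩ := Metric.uniformContinuous_iff.1 (uniformContinuous_coulombReg hδ)
        (κ / 2 / (B + 1)) (by positivity)
      filter_upwards [hVB, hζ.eventually (Metric.ball_mem_nhds ζ₀ hr),
        Metric.tendstoUniformly_iff.1 hV (κ / 2 * δ) (by positivity)] with i h1 h2 h3 x
      have h4 : ‖coulombReg δ (x - ζ₀) - coulombReg δ (x - ζ i)‖ ≤ κ / 2 / (B + 1) := by
        rw [← dist_eq_norm]
        refine (hru ?_).le
        rw [dist_sub_left, dist_comm]
        exact h2
      have h5 := h3 x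
      rw [dist_eq_norm] at h5
      calc dist _ _ = ‖inner ℝ (coulombReg δ (x - ζ₀)) (V₀ x - V i x)
            + inner ℝ (coulombReg δ (x - ζ₀) - coulombReg δ (x - ζ i)) (V i x)‖ := by
            rw [dist_eq_norm, inner_sub_right, inner_sub_left]; ring_nf
        _ ≤ ‖coulombReg δ (x - ζ₀)‖ * ‖V₀ x - V i x‖
            + ‖coulombReg δ (x - ζ₀) - coulombReg δ (x - ζ i)‖ * ‖V i x‖ :=
            (norm_add_le _ _).trans (add_le_add (norm_inner_le_norm _ _) (norm_inner_le_norm _ _))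
        _ < δ⁻¹ * (κ / 2 * δ) + κ / 2 / (B + 1) * (B + 1) := by
            refine add_lt_add_of_lt_of_le ?_ ?_
            · refine (mul_le_mul_of_nonneg_right (norm_coulombReg_le_inv hδ _)
                (norm_nonneg _)).trans_lt ?_
              gcongr
            · gcongr; exact h1 x
        _ = κ := by field_simp; norm_num
    · filter_upwards [hVB, hτ'] with i h1 h2
      have := hρ.finite _ h2.1
      exact integrable_inner_coulombReg hδ _ (hVc i) h1
  filter_upwards [hVB, hτ', Metric.tendsto_nhds.1 hreg (ε / 2) (by positivity)] with i h1 h2 h3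
  have hf1 := hρ.finite _ h2.1
  have hf2 := hρ.finite _ ht
  have e1 := (hnear _ h2).abs_integral_sub_le hδ (ζ i) (hVc i) h1
  have e2 := (hnear t ⟨ht, by linarith⟩).abs_integral_sub_le hδ ζ₀ hV₀c
    (fun x => (hB x).trans (by linarith : B ≤ B + 1))
  have e3 : (B + 1) * (ε / 4 / (B + 1)) = ε / 4 := by field_simp
  rw [e3] at e1 e2
  rw [Real.dist_eq] at h3 ⊢
  rw [abs_lt] at h3 ⊢
  rw [abs_le] at e1 e2
  constructor <;> linarith [e1.1, e1.2, e2.1, e2.2, h3.1, h3.2]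

theorem NearFieldVanishes.integrable_coulomb {ρ : ℝ → Measure Plane} (hρ : WeaklyContinuous ρ)
    (hN : NearFieldVanishes ρ) {t : ℝ} (ht : 0 ≤ t) (x : Plane) :
    Integrable (fun y => coulomb (x - y)) (ρ t) := by
  obtain ⟨δ, hδ, h⟩ := hN t 1 one_pos
  have := hρ.finite t ht
  exact (h t ⟨ht, le_rfl⟩).integrable_coulomb hδ x

theorem inner_field {μ : Measure Plane} {x : Plane} (h : Integrable (fun y => coulomb (x - y)) μ)
    (a : Plane) : inner ℝ a (field μ x) = -∫ y, inner ℝ (coulomb (y - x)) a ∂μ := by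
  rw [field, ← integral_inner h, ← integral_neg]
  refine integral_congr_ae (Eventually.of_forall fun y => ?_)
  simp only
  rw [real_inner_comm, ← inner_neg_left, ← coulomb_neg, neg_sub]

theorem tendsto_max_zero_nhdsWithin (t : ℝ) :
    Tendsto (fun s : ℝ => max s 0) (𝓝 t) (𝓝[Ici 0] (max t 0)) :=
  tendsto_nhdsWithin_iff.2 ⟨(continuous_id.max continuous_const).tendsto t,
    Eventually.of_forall fun s => mem_Ici.2 (le_max_right s 0)⟩

/-- Each component of the field is a singular integral against a constant vector. The time is
clamped by `max · 0` because nothing is known of `ρ` at negative times. -/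
theorem continuous_field {ρ : ℝ → Measure Plane} (hρ : WeaklyContinuous ρ)
    (hN : NearFieldVanishes ρ) :
    Continuous (fun z : ℝ × Plane => field (ρ (max z.1 0)) z.2) := by
  have key : ∀ a : Plane, Continuous (fun z : ℝ × Plane =>
      inner ℝ a (field (ρ (max z.1 0)) z.2)) := by
    intro a
    rw [continuous_iff_continuousAt]
    intro z
    have : (fun z : ℝ × Plane => inner ℝ a (field (ρ (max z.1 0)) z.2))
        = fun z => -∫ y, inner ℝ (coulomb (y - z.2)) a ∂(ρ (max z.1 0)) := by
      ext z
      exact inner_field (hN.integrable_coulomb hρ (le_max_right _ _) _) a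
    rw [this]
    exact (hρ.tendsto_integral_coulomb hN (le_max_right _ _)
      ((tendsto_max_zero_nhdsWithin z.1).comp continuous_fst.continuousAt)
      continuous_snd.continuousAt (V := fun _ _ => a) (V₀ := fun _ => a)
      (fun u hu => Eventually.of_forall fun _ _ => refl_mem_uniformity hu)
      (fun _ => continuous_const) continuous_const
      (fun _ => le_rfl)).neg
  have h2 : Continuous (fun z : ℝ × Plane =>
      WithLp.toLp 2 fun i : Fin 2 => inner ℝ (EuclideanSpace.single i (1 : ℝ))
        (field (ρ (max z.1 0)) z.2)) :=
    (PiLp.continuous_toLp 2 _).comp (continuous_pi fun i => key _)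
  convert h2 using 2 with z
  ext i
  simp [EuclideanSpace.inner_single_left]

/-! ### Time continuity of integrals of compactly supported space-time functions -/

theorem tendsto_cocompact_of_hasCompactSupport_prod {E : Type*} [NormedAddCommGroup E]
    {F : ℝ × Plane → E} (hF : HasCompactSupport F) (t : ℝ) :
    Tendsto (fun x => F (t, x)) (cocompact Plane) (𝓝 0) :=
  hF.is_zero_at_infty.comp
    (Isometry.of_dist_eq fun x y => by simp [Prod.dist_eq]).isClosedEmbedding.tendsto_cocompact

theorem tendstoUniformly_of_hasCompactSupport {E : Type*} [NormedAddCommGroup E]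
    {F : ℝ × Plane → E} (hF : HasCompactSupport F) (hFc : Continuous F) (t : ℝ) :
    TendstoUniformly (fun s x => F (s, x)) (fun x => F (t, x)) (𝓝 t) :=
  UniformContinuous₂.tendstoUniformly
    (hFc.uniformContinuous_of_tendsto_cocompact hF.is_zero_at_infty)

theorem WeaklyContinuous.continuousOn_integral {ρ : ℝ → Measure Plane} (hρ : WeaklyContinuous ρ)
    {F : ℝ × Plane → ℝ} (hF : HasCompactSupport F) (hFc : Continuous F) :
    ContinuousOn (fun t => ∫ x, F (t, x) ∂(ρ t)) (Ici 0) := by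
  intro t ht
  refine hρ.tendsto_integral ht tendsto_id (hFc.comp (by fun_prop))
    (tendsto_cocompact_of_hasCompactSupport_prod hF t)
    (fun u hu => (tendstoUniformly_of_hasCompactSupport hF hFc t u hu).filter_mono
      nhdsWithin_le_nhds) ?_
  filter_upwards [self_mem_nhdsWithin] with s hs
  have := hρ.finite s hs
  rw [id]
  obtain ⟨C, hC⟩ := hF.exists_bound_of_continuous hFc
  exact (integrable_const C).mono' (hFc.comp (by fun_prop : Continuous fun x : Plane => (s, x))
    ).aestronglyMeasurable (Eventually.of_forall fun x => hC _)

theorem WeaklyContinuous.continuousOn_integral_coulomb {ρ : ℝ → Measure Plane}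
    (hρ : WeaklyContinuous ρ) (hN : NearFieldVanishes ρ) {ξ : ℝ → Plane}
    (hξ : ContinuousOn ξ (Ici 0)) {V : ℝ × Plane → Plane} (hV : HasCompactSupport V)
    (hVc : Continuous V) :
    ContinuousOn (fun t => ∫ x, inner ℝ (coulomb (x - ξ t)) (V (t, x)) ∂(ρ t)) (Ici 0) := by
  intro t ht
  obtain ⟨C, hC⟩ := hV.exists_bound_of_continuous hVc
  exact hρ.tendsto_integral_coulomb hN ht tendsto_id (hξ t ht)
    (V := fun s x => V (s, x)) (V₀ := fun x => V (t, x))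
    (fun u hu => (tendstoUniformly_of_hasCompactSupport hV hVc t u hu).filter_mono
      nhdsWithin_le_nhds) (fun s => hVc.comp (by fun_prop)) (hVc.comp (by fun_prop))
      (fun x => hC _)

/-! ### Test functions -/

namespace IsTest

variable {Φ : ℝ → Plane → ℝ}

theorem differentiable (hΦ : IsTest Φ) : Differentiable ℝ (fun z : ℝ × Plane => Φ z.1 z.2) :=
  hΦ.smooth.differentiable (by simp)

theorem hasFDerivAt (hΦ : IsTest Φ) (z : ℝ × Plane) :
    HasFDerivAt (fun z : ℝ × Plane => Φ z.1 z.2)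
      (fderiv ℝ (fun z : ℝ × Plane => Φ z.1 z.2) z) z :=
  (hΦ.differentiable z).hasFDerivAt

theorem continuous_fderiv (hΦ : IsTest Φ) :
    Continuous (fderiv ℝ (fun z : ℝ × Plane => Φ z.1 z.2)) :=
  hΦ.smooth.continuous_fderiv (by simp)

theorem deriv_eq (hΦ : IsTest Φ) (z : ℝ × Plane) :
    deriv (fun s => Φ s z.2) z.1 = fderiv ℝ (fun z : ℝ × Plane => Φ z.1 z.2) z (1, 0) := by
  have h : HasDerivAt (fun s : ℝ => (s, z.2)) ((1 : ℝ), (0 : Plane)) z.1 :=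
    (hasDerivAt_id _).prodMk (hasDerivAt_const _ _)
  exact ((hΦ.hasFDerivAt z).comp_hasDerivAt z.1 h).deriv

theorem gradient_eq (hΦ : IsTest Φ) (z : ℝ × Plane) :
    gradient (Φ z.1) z.2 = (InnerProductSpace.toDual ℝ Plane).symm
      ((fderiv ℝ (fun z : ℝ × Plane => Φ z.1 z.2) z).comp (ContinuousLinearMap.inr ℝ ℝ Plane)) := by
  have h : HasFDerivAt (fun x : Plane => (z.1, x)) (ContinuousLinearMap.inr ℝ ℝ Plane) z.2 :=
    hasFDerivAt_prodMk_right _ _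
  have h2 := HasFDerivAt.comp (g := fun z : ℝ × Plane => Φ z.1 z.2) z.2 (hΦ.hasFDerivAt z) h
  rw [gradient, ← h2.fderiv]
  rfl

theorem inner_gradient (hΦ : IsTest Φ) (z : ℝ × Plane) (w : Plane) :
    inner ℝ (gradient (Φ z.1) z.2) w = fderiv ℝ (fun z : ℝ × Plane => Φ z.1 z.2) z (0, w) := by
  rw [hΦ.gradient_eq, InnerProductSpace.toDual_symm_apply]
  simp

theorem continuous_deriv (hΦ : IsTest Φ) :
    Continuous (fun z : ℝ × Plane => deriv (fun s => Φ s z.2) z.1) := by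
  simp_rw [hΦ.deriv_eq]
  exact hΦ.continuous_fderiv.clm_apply continuous_const

theorem continuous_gradient (hΦ : IsTest Φ) :
    Continuous (fun z : ℝ × Plane => gradient (Φ z.1) z.2) := by
  simp_rw [hΦ.gradient_eq]
  exact (LinearIsometryEquiv.continuous _).comp (hΦ.continuous_fderiv.clm_comp continuous_const)

theorem hasCompactSupport_deriv (hΦ : IsTest Φ) :
    HasCompactSupport (fun z : ℝ × Plane => deriv (fun s => Φ s z.2) z.1) := by
  refine (hΦ.compact.fderiv ℝ).mono fun z hz h => hz ?_
  simp only [hΦ.deriv_eq, h]; simp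

theorem hasCompactSupport_gradient (hΦ : IsTest Φ) :
    HasCompactSupport (fun z : ℝ × Plane => gradient (Φ z.1) z.2) := by
  refine (hΦ.compact.fderiv ℝ).mono fun z hz h => hz ?_
  simp only [hΦ.gradient_eq, h]; simp

theorem hasDerivAt_comp (hΦ : IsTest Φ) {ξ : ℝ → Plane} {ξ' : Plane} {t : ℝ}
    (hξ : HasDerivAt ξ ξ' t) :
    HasDerivAt (fun s => Φ s (ξ s))
      (deriv (fun s => Φ s (ξ t)) t + inner ℝ (gradient (Φ t) (ξ t)) ξ') t := by
  have h := (hΦ.hasFDerivAt (t, ξ t)).comp_hasDerivAt t ((hasDerivAt_id t).prodMk hξ)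
  rw [hΦ.deriv_eq (t, ξ t), hΦ.inner_gradient (t, ξ t), ← map_add]
  simpa [Function.comp_def] using h

theorem exists_forall_eq_zero (hΦ : IsTest Φ) : ∃ T : ℝ, 0 < T ∧ ∀ t, T ≤ t → ∀ x, Φ t x = 0 ∧
    deriv (fun s => Φ s x) t = 0 ∧ gradient (Φ t) x = 0 := by
  obtain ⟨R, hR0, hR⟩ := hΦ.compact.isCompact.isBounded.exists_pos_norm_lt
  refine ⟨R, hR0, fun t ht x => ?_⟩
  have hz : (t, x) ∉ tsupport (fun z : ℝ × Plane => Φ z.1 z.2) := fun h => by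
    have h1 : ‖t‖ ≤ ‖(t, x)‖ := norm_fst_le (t, x)
    linarith [hR _ h, le_abs_self t, Real.norm_eq_abs t]
  have hd : fderiv ℝ (fun z : ℝ × Plane => Φ z.1 z.2) (t, x) = 0 := by
    by_contra h
    exact hz (support_fderiv_subset ℝ h)
  refine ⟨image_eq_zero_of_notMem_tsupport (f := fun z : ℝ × Plane => Φ z.1 z.2) hz, ?_, ?_⟩
  · rw [hΦ.deriv_eq (t, x), hd]; simp
  · rw [hΦ.gradient_eq (t, x), hd]; simp

end IsTest

/-! ### The quadratic form as a transport term -/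

/-- The kernel is odd, so exchanging the variables identifies the two halves of `H_Φ` and cancels
the factor `1/2`; Fubini then produces the field. Integrability of the kernel is what allows the
halves to be separated. -/
theorem hForm_self {μ : Measure Plane} [IsFiniteMeasure μ]
    (hμ : Integrable (fun z : Plane × Plane => coulomb (z.1 - z.2)) (μ.prod μ))
    {Φ : Plane → ℝ} (hΦ : Continuous (gradient Φ)) {B : ℝ} (hB : ∀ x, ‖gradient Φ x‖ ≤ B) :
    hForm Φ μ μ = ∫ x, inner ℝ (perp (field μ x)) (gradient Φ x) ∂μ := by
  have hint : Integrable (fun z : Plane × Plane =>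
      inner ℝ (perp (coulomb (z.1 - z.2))) (gradient Φ z.1)) (μ.prod μ) := by
    refine (hμ.norm.mul_const B).mono' ?_ (Eventually.of_forall fun z => ?_)
    · exact ((continuous_perp.measurable.comp (measurable_coulomb.comp
        (measurable_fst.sub measurable_snd))).inner
        (hΦ.measurable.comp measurable_fst)).aestronglyMeasurable
    · refine (norm_inner_le_norm _ _).trans ?_
      rw [norm_perp]
      gcongr
      exact hB _
  have hswap : ∀ z : Plane × Plane, inner ℝ (perp (coulomb (z.1 - z.2))) (gradient Φ z.2)
      = -inner ℝ (perp (coulomb (z.swap.1 - z.swap.2))) (gradient Φ z.swap.1) := fun z => by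
    rw [← inner_neg_left, ← perp_neg, ← coulomb_neg]
    simp
  have h1 : ∫ z : Plane × Plane, hKernel Φ z.1 z.2 ∂(μ.prod μ)
      = 2 * ∫ z : Plane × Plane, inner ℝ (perp (coulomb (z.1 - z.2))) (gradient Φ z.1)
        ∂(μ.prod μ) := by
    simp only [hKernel, inner_sub_right, hswap, sub_neg_eq_add]
    have hsw : Integrable (fun z : Plane × Plane =>
      inner ℝ (perp (coulomb (z.swap.1 - z.swap.2))) (gradient Φ z.swap.1)) (μ.prod μ) := hint.swap
    rw [integral_add hint hsw, integral_prod_swap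
      (fun z : Plane × Plane => inner ℝ (perp (coulomb (z.1 - z.2))) (gradient Φ z.1)), two_mul]
  rw [hForm, h1, integral_prod _ hint, ← mul_assoc, one_div, inv_mul_cancel₀ two_ne_zero, one_mul]
  refine integral_congr_ae ?_
  filter_upwards [hμ.prod_right_ae] with x hx
  have hx' : Integrable (fun y => perp (coulomb (x - y))) μ :=
    perpIso.toContinuousLinearMap.integrable_comp hx
  rw [field, perp_integral, real_inner_comm, ← integral_inner hx']
  simp only [real_inner_comm]

/-! ### From distributions on `(0, ∞)` to the initial value -/

theorem integrableOn_Ioi_of_eq_zero {G : ℝ → ℝ} (hG : ContinuousOn G (Ici 0)) {T : ℝ}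
    (hG0 : ∀ t, T ≤ t → G t = 0) : IntegrableOn G (Ioi 0) := by
  have h1 : IntegrableOn G (Icc 0 T) :=
    (hG.mono Icc_subset_Ici_self).integrableOn_compact isCompact_Icc
  have h2 : IntegrableOn G (Ioi T) :=
    integrableOn_zero.congr_fun (fun t ht => (hG0 t (le_of_lt ht)).symm) measurableSet_Ioi
  exact (h1.union h2).mono_set fun t ht => by
    rcases le_or_gt t T with h3 | h3
    · exact Or.inl ⟨le_of_lt ht, h3⟩
    · exact Or.inr h3

/-- Test with cutoffs that rise from `0` to `1` between `1/(n+1)` and `2/(n+1)`: they tend to `1`,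
while their derivatives near `0` are approximate unit masses that select `g 0`. -/
theorem integral_add_initial_eq_zero {g G : ℝ → ℝ} (hg : ContinuousOn g (Ici 0))
    (hG : ContinuousOn G (Ici 0)) {T : ℝ} (hT : 0 < T) (hg0 : ∀ t, T ≤ t → g t = 0)
    (hG0 : ∀ t, T ≤ t → G t = 0)
    (h : ∀ θ : ℝ → ℝ, ContDiff ℝ ∞ θ → HasCompactSupport θ → tsupport θ ⊆ Ioi 0 →
      -(∫ t in Ioi (0 : ℝ), deriv θ t * g t) = ∫ t in Ioi (0 : ℝ), θ t * G t) :
    (∫ t in Ioi (0 : ℝ), G t) + g 0 = 0 := by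
  have hbd : ∀ {k : ℝ → ℝ}, ContinuousOn k (Ici 0) → (∀ t, T ≤ t → k t = 0) →
      ∃ C, ∀ t, 0 ≤ t → ‖k t‖ ≤ C := fun {k} hk hk0 => by
    obtain ⟨C, hC⟩ := isCompact_Icc.exists_bound_of_continuousOn
      (hk.mono (Icc_subset_Ici_self : Icc 0 T ⊆ Ici 0))
    refine ⟨C, fun t ht => ?_⟩
    rcases le_or_gt t T with h1 | h1
    · exact hC t ⟨ht, h1⟩
    · rw [hk0 t h1.le, norm_zero]; exact (norm_nonneg _).trans (hC 0 ⟨le_rfl, hT.le⟩)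
  obtain ⟨Cg, hCg⟩ := hbd hg hg0
  have hGi := integrableOn_Ioi_of_eq_zero hG hG0
  let S := Real.smoothTransition
  have hS : ContDiff ℝ ∞ S := Real.smoothTransition.contDiff
  -- Only makes the support compact: it equals `1` up to time `T`, beyond which `g` and `G` vanish.
  let c : ContDiffBump (0 : ℝ) := ⟨T + 1, T + 2, by linarith, by linarith⟩
  let θ : ℕ → ℝ → ℝ := fun n t => S ((n + 1) * t - 1) * c t
  have hθs : ∀ n, ContDiff ℝ ∞ (θ n) := fun n =>
    (hS.comp (by fun_prop)).mul c.contDiff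
  have hθc : ∀ n, HasCompactSupport (θ n) := fun n => c.hasCompactSupport.mul_left
  have hθt : ∀ n, tsupport (θ n) ⊆ Ioi 0 := fun n => by
    have h1 : tsupport (θ n) ⊆ Ici (1 / ((n : ℝ) + 1)) := by
      refine closure_minimal (fun t ht => ?_) isClosed_Ici
      by_contra h2
      refine ht ?_
      have h3 : ((n : ℝ) + 1) * t - 1 ≤ 0 := by
        rw [mem_Ici, not_le, lt_div_iff₀ (by positivity)] at h2; linarith
      simp [θ, S, Real.smoothTransition.zero_of_nonpos h3]
    exact h1.trans fun t ht => lt_of_lt_of_le (by positivity) (mem_Ici.1 ht)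
  have hθ1 : ∀ n t, 0 < t → deriv (θ n) t * g t = (n + 1) * deriv S ((n + 1) * t - 1) * g t := by
    intro n t ht
    rcases le_or_gt T t with h1 | h1
    · simp [hg0 t h1]
    · have h2 : θ n =ᶠ[𝓝 t] fun t => S ((n + 1) * t - 1) := by
        have : Ioo 0 T ∈ 𝓝 t := Ioo_mem_nhds ht h1
        filter_upwards [this] with s hs
        have : c s = 1 := c.one_of_mem_closedBall (by
          rw [mem_closedBall_zero_iff, Real.norm_of_nonneg hs.1.le]
          exact hs.2.le.trans (by simp [c]))
        simp [θ, this]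
      have h3 : HasDerivAt (fun t : ℝ => ((n : ℝ) + 1) * t - 1) ((n : ℝ) + 1) t := by
        simpa using ((hasDerivAt_id t).const_mul ((n : ℝ) + 1)).sub_const 1
      have h4 := ((hS.differentiable (by simp)) (((n : ℝ) + 1) * t - 1)).hasDerivAt.comp t h3
      rw [h2.deriv_eq]
      rw [show deriv (fun t => S (((n : ℝ) + 1) * t - 1)) t = _ from h4.deriv]
      ring
  -- The substitution `s = (n + 1) t` puts the concentration into the argument of `g`, ready for
  -- dominated convergence.
  have hθ2 : ∀ n : ℕ, ∫ t in Ioi (0 : ℝ), deriv (θ n) t * g t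
      = ∫ s in Ioi (0 : ℝ), deriv S (s - 1) * g (((n : ℝ) + 1)⁻¹ * s) := fun n => by
    have hn : (0 : ℝ) < (n : ℝ) + 1 := by positivity
    rw [setIntegral_congr_fun measurableSet_Ioi fun t ht => hθ1 n t ht]
    have := integral_comp_mul_left_Ioi
      (fun s => deriv S (s - 1) * g (((n : ℝ) + 1)⁻¹ * s)) 0 hn
    rw [mul_zero, smul_eq_mul, eq_inv_mul_iff_mul_eq₀ hn.ne', ← integral_const_mul] at this
    rw [← this]
    refine setIntegral_congr_fun measurableSet_Ioi fun t _ => ?_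
    rw [inv_mul_cancel_left₀ hn.ne', mul_assoc]
  have hS0 : ∀ s, s ∉ Icc (1 : ℝ) 2 → deriv S (s - 1) = 0 := fun s hs => by
    rcases lt_or_ge s 1 with h1 | h1
    · have : S =ᶠ[𝓝 (s - 1)] fun _ => 0 := by
        filter_upwards [Iio_mem_nhds (show s - 1 < 0 by linarith)] with r hr
        exact Real.smoothTransition.zero_of_nonpos (le_of_lt hr)
      rw [this.deriv_eq, deriv_const]
    · have h2 : 2 < s := by by_contra h2; exact hs ⟨h1, not_lt.1 h2⟩
      have : S =ᶠ[𝓝 (s - 1)] fun _ => 1 := by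
        filter_upwards [Ioi_mem_nhds (show 1 < s - 1 by linarith)] with r hr
        exact Real.smoothTransition.one_of_one_le (le_of_lt hr)
      rw [this.deriv_eq, deriv_const]
  have hSd : Continuous fun s => deriv S (s - 1) :=
    (hS.continuous_deriv (by simp)).comp (by fun_prop)
  have hSi : Integrable fun s => deriv S (s - 1) :=
    hSd.integrable_of_hasCompactSupport (HasCompactSupport.intro isCompact_Icc fun s hs => hS0 s hs)
  have hS1 : ∫ s in Ioi (0 : ℝ), deriv S (s - 1) = 1 := by
    have h1 : ∀ s ∈ Ioi (0 : ℝ), HasDerivAt (fun s => S (s - 1)) (deriv S (s - 1)) s := fun s _ => by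
      have h3 : HasDerivAt (fun t : ℝ => t - 1) 1 s := (hasDerivAt_id s).sub_const 1
      simpa [Function.comp_def] using ((hS.differentiable (by simp)) (s - 1)).hasDerivAt.comp s h3
    have h2 : Tendsto (fun s => S (s - 1)) atTop (𝓝 1) := by
      refine tendsto_const_nhds.congr' ?_
      filter_upwards [eventually_ge_atTop 2] with s hs
      exact (Real.smoothTransition.one_of_one_le (by linarith)).symm
    have h4 : Continuous fun s => S (s - 1) := hS.continuous.comp (by fun_prop)
    rw [integral_Ioi_of_hasDerivAt_of_tendsto h4.continuousWithinAt h1 hSi.integrableOn h2]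
    simp [S, Real.smoothTransition.zero_of_nonpos]
  have hlim1 : Tendsto (fun n : ℕ => ∫ s in Ioi (0 : ℝ),
      deriv S (s - 1) * g (((n : ℝ) + 1)⁻¹ * s)) atTop (𝓝 (g 0)) := by
    have h1 : ∫ s in Ioi (0 : ℝ), deriv S (s - 1) * g 0 = g 0 := by
      rw [integral_mul_const, hS1, one_mul]
    rw [← h1]
    have hn : Tendsto (fun n : ℕ => ((n : ℝ) + 1)⁻¹) atTop (𝓝 0) := by
      simpa using tendsto_one_div_add_atTop_nhds_zero_nat (𝕜 := ℝ)
    refine tendsto_integral_of_dominated_convergence (fun s => ‖deriv S (s - 1)‖ * Cg)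
      (fun n => ?_) (hSi.norm.mul_const Cg).integrableOn (fun n => ?_) ?_
    · refine (hSd.continuousOn.mul (hg.comp (by fun_prop) fun s hs => ?_)).aestronglyMeasurable
        measurableSet_Ioi
      have : 0 < s := hs
      exact mem_Ici.2 (by positivity)
    · filter_upwards [ae_restrict_mem measurableSet_Ioi] with s hs
      have : 0 < s := hs
      rw [norm_mul]
      gcongr
      exact hCg _ (by positivity)
    · filter_upwards [ae_restrict_mem measurableSet_Ioi] with s hs
      have hs' : 0 < s := hs
      refine Tendsto.const_mul _ ((hg 0 self_mem_Ici).tendsto.comp (tendsto_nhdsWithin_iff.2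
        ⟨by simpa using hn.mul_const s, Eventually.of_forall fun n => ?_⟩))
      exact mem_Ici.2 (by positivity)
  have hlim2 : Tendsto (fun n : ℕ => ∫ t in Ioi (0 : ℝ), θ n t * G t) atTop
      (𝓝 (∫ t in Ioi (0 : ℝ), G t)) := by
    refine tendsto_integral_of_dominated_convergence (fun t => ‖G t‖)
      (fun n => ?_) hGi.norm (fun n => ?_) ?_
    · exact ((hθs n).continuous.continuousOn.mul (hG.mono Ioi_subset_Ici_self)).aestronglyMeasurable
        measurableSet_Ioi
    · filter_upwards with t
      rw [norm_mul]
      refine mul_le_of_le_one_left (norm_nonneg _) ?_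
      rw [Real.norm_of_nonneg (mul_nonneg (Real.smoothTransition.nonneg _) c.nonneg)]
      exact mul_le_one₀ (Real.smoothTransition.le_one _) c.nonneg c.le_one
    · filter_upwards [ae_restrict_mem measurableSet_Ioi] with t ht
      refine tendsto_const_nhds.congr' ?_
      have hn : Tendsto (fun n : ℕ => ((n : ℝ) + 1) * t) atTop atTop :=
        (tendsto_natCast_atTop_atTop.atTop_add tendsto_const_nhds).atTop_mul_const ht
      filter_upwards [hn.eventually_ge_atTop 2] with n hn
      rcases le_or_gt T t with h1 | h1
      · simp [hG0 t h1]
      · have h2 : c t = 1 := c.one_of_mem_closedBall (by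
          rw [mem_closedBall_zero_iff, Real.norm_of_nonneg (le_of_lt ht)]
          exact h1.le.trans (by simp [c]))
        have h3 : S (((n : ℝ) + 1) * t - 1) = 1 :=
          Real.smoothTransition.one_of_one_le (by linarith)
        simp [θ, h2, h3]
  have hlim3 := hlim1.neg
  have : ∀ n : ℕ, -(∫ s in Ioi (0 : ℝ), deriv S (s - 1) * g (((n : ℝ) + 1)⁻¹ * s))
      = ∫ t in Ioi (0 : ℝ), θ n t * G t := fun n => by
    rw [← hθ2 n]; exact h (θ n) (hθs n) (hθc n) (hθt n)
  simp only [this] at hlim3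
  linarith [tendsto_nhds_unique hlim2 hlim3]

/-! ### The velocity -/

theorem continuous_field_apply {ρ : ℝ → Measure Plane} (hρ : WeaklyContinuous ρ)
    (hN : NearFieldVanishes ρ) {t : ℝ} (ht : 0 ≤ t) : Continuous (field (ρ t)) := by
  have h := (continuous_field hρ hN).comp (by fun_prop : Continuous fun x : Plane => (t, x))
  simpa [Function.comp_def, max_eq_left ht] using h

theorem exists_integral_norm_coulomb_le {ρ : ℝ → Measure Plane} (hρ : WeaklyContinuous ρ)
    (hN : NearFieldVanishes ρ) (T : ℝ) :
    ∃ C : ℝ, 0 ≤ C ∧ ∀ t ∈ Icc 0 T, ∀ x, ∫ y, ‖coulomb (x - y)‖ ∂(ρ t) ≤ C := by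
  obtain ⟨δ, hδ, h⟩ := hN T 1 one_pos
  obtain ⟨M, hM0, hM⟩ := hρ.exists_mass_le T
  refine ⟨1 + δ⁻¹ * M, by positivity, fun t ht x => ?_⟩
  have := hρ.finite t ht.1
  refine ((h t ht).integral_norm_coulomb_le hδ x).trans ?_
  gcongr
  exact hM t ht

theorem exists_norm_field_le {ρ : ℝ → Measure Plane} (hρ : WeaklyContinuous ρ)
    (hN : NearFieldVanishes ρ) (T : ℝ) :
    ∃ C : ℝ, 0 ≤ C ∧ ∀ t ∈ Icc 0 T, ∀ x, ‖field (ρ t) x‖ ≤ C := by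
  obtain ⟨C, hC0, hC⟩ := exists_integral_norm_coulomb_le hρ hN T
  exact ⟨C, hC0, fun t ht x => (norm_integral_le_integral_norm _).trans (hC t ht x)⟩

theorem integrable_perp_field {ρ : ℝ → Measure Plane} (hρ : WeaklyContinuous ρ)
    (hN : NearFieldVanishes ρ) {t : ℝ} (ht : 0 ≤ t) :
    Integrable (fun x => perp (field (ρ t) x)) (ρ t) := by
  obtain ⟨C, -, hC⟩ := exists_norm_field_le hρ hN t
  have := hρ.finite t ht
  refine (integrable_const C).mono'
    (continuous_perp.comp (continuous_field_apply hρ hN ht)).aestronglyMeasurable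
    (Eventually.of_forall fun x => ?_)
  rw [norm_perp]
  exact hC t ⟨ht, le_rfl⟩ x

theorem integrable_perp_coulomb {ρ : ℝ → Measure Plane} (hρ : WeaklyContinuous ρ)
    (hN : NearFieldVanishes ρ) {t : ℝ} (ht : 0 ≤ t) (ζ : Plane) :
    Integrable (fun x => perp (coulomb (x - ζ))) (ρ t) := by
  have h := perpIso.toContinuousLinearMap.integrable_comp
    (hN.integrable_coulomb hρ ht ζ).neg
  refine h.congr (Eventually.of_forall fun x => ?_)
  change perp (-coulomb (ζ - x)) = _
  rw [← coulomb_neg, neg_sub]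

theorem integrable_velocity {ρ : ℝ → Measure Plane} (hρ : WeaklyContinuous ρ)
    (hN : NearFieldVanishes ρ) (γ : ℝ) {t : ℝ} (ht : 0 ≤ t) (ζ : Plane) :
    Integrable (velocity γ (ρ t) ζ) (ρ t) :=
  (integrable_perp_field hρ hN ht).add ((integrable_perp_coulomb hρ hN ht ζ).smul γ)

theorem Integrable.inner_bounded {μ : Measure Plane} {u V : Plane → Plane}
    (hu : Integrable u μ) (hV : Continuous V) {B : ℝ} (hB : ∀ x, ‖V x‖ ≤ B) :
    Integrable (fun x => inner ℝ (u x) (V x)) μ := by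
  refine (hu.norm.mul_const B).mono' (hu.aestronglyMeasurable.inner hV.aestronglyMeasurable)
    (Eventually.of_forall fun x => (norm_inner_le_norm _ _).trans ?_)
  gcongr
  exact hB x

theorem IsTest.exists_bound {Φ : ℝ → Plane → ℝ} (hΦ : IsTest Φ) :
    ∃ B : ℝ, ∀ t x, ‖gradient (Φ t) x‖ ≤ B ∧ ‖deriv (fun s => Φ s x) t‖ ≤ B := by
  obtain ⟨B, hB⟩ := hΦ.hasCompactSupport_gradient.exists_bound_of_continuous hΦ.continuous_gradient
  obtain ⟨B', hB'⟩ := hΦ.hasCompactSupport_deriv.exists_bound_of_continuous hΦ.continuous_deriv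
  exact ⟨max B B', fun t x => ⟨(hB (t, x)).trans (le_max_left _ _),
    (hB' (t, x)).trans (le_max_right _ _)⟩⟩

theorem IsTest.continuous_gradient_apply {Φ : ℝ → Plane → ℝ} (hΦ : IsTest Φ) (t : ℝ) :
    Continuous (gradient (Φ t)) :=
  hΦ.continuous_gradient.comp (by fun_prop : Continuous fun x : Plane => (t, x))

theorem IsTest.integrable_deriv {Φ : ℝ → Plane → ℝ} (hΦ : IsTest Φ) (t : ℝ) (μ : Measure Plane)
    [IsFiniteMeasure μ] : Integrable (fun x => deriv (fun s => Φ s x) t) μ := by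
  obtain ⟨B, hB⟩ := hΦ.exists_bound
  exact (integrable_const B).mono' (hΦ.continuous_deriv.comp
    (by fun_prop : Continuous fun x : Plane => (t, x))).aestronglyMeasurable
    (Eventually.of_forall fun x => (hB t x).2)

theorem IsTest.integrable_inner_gradient {Φ : ℝ → Plane → ℝ} (hΦ : IsTest Φ) (t : ℝ)
    {μ : Measure Plane} {u : Plane → Plane} (hu : Integrable u μ) :
    Integrable (fun x => inner ℝ (u x) (gradient (Φ t) x)) μ := by
  obtain ⟨B, hB⟩ := hΦ.exists_bound
  exact Integrable.inner_bounded hu (hΦ.continuous_gradient_apply t) fun x => (hB t x).1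

/-- The space integral in the weak formulation of the transport equation. -/
def flux (γ : ℝ) (ρ : ℝ → Measure Plane) (ξ : ℝ → Plane) (Φ : ℝ → Plane → ℝ) (t : ℝ) : ℝ :=
  ∫ x, (deriv (fun s => Φ s x) t
    + inner ℝ (velocity γ (ρ t) (ξ t) x) (gradient (Φ t) x)) ∂(ρ t)

/-- The contribution of `E^⊥` and of the time derivative is a continuous compactly supported
integrand; that of the charge is a singular integral with moving pole, once the rotation is passed
to the gradient. -/
theorem continuousOn_flux {ρ : ℝ → Measure Plane} (hρ : WeaklyContinuous ρ)
    (hN : NearFieldVanishes ρ) (γ : ℝ) {ξ : ℝ → Plane} (hξ : ContinuousOn ξ (Ici 0))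
    {Φ : ℝ → Plane → ℝ} (hΦ : IsTest Φ) : ContinuousOn (flux γ ρ ξ Φ) (Ici 0) := by
  let F : ℝ × Plane → ℝ := fun z => deriv (fun s => Φ s z.2) z.1
    + inner ℝ (perp (field (ρ (max z.1 0)) z.2)) (gradient (Φ z.1) z.2)
  have hFc : Continuous F := hΦ.continuous_deriv.add
    ((continuous_perp.comp (continuous_field hρ hN)).inner hΦ.continuous_gradient)
  have hF : HasCompactSupport F := by
    refine hΦ.hasCompactSupport_deriv.add (hΦ.hasCompactSupport_gradient.mono fun z hz h => hz ?_)
    simp only [h, inner_zero_right]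
  have hV : HasCompactSupport (fun z : ℝ × Plane => perp (gradient (Φ z.1) z.2)) :=
    hΦ.hasCompactSupport_gradient.comp_left (g := perp) perpIso.map_zero
  refine ((hρ.continuousOn_integral hF hFc).sub ((hρ.continuousOn_integral_coulomb hN hξ hV
    (continuous_perp.comp hΦ.continuous_gradient)).const_mul γ)).congr fun t ht => ?_
  have := hρ.finite t ht
  have i1 := hΦ.integrable_deriv t (ρ t)
  have i2 := hΦ.integrable_inner_gradient t (integrable_perp_field hρ hN ht)
  have i3 := hΦ.integrable_inner_gradient t (integrable_perp_coulomb hρ hN ht (ξ t))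
  change flux γ ρ ξ Φ t = ∫ x, F (t, x) ∂(ρ t)
    - γ * ∫ x, inner ℝ (coulomb (x - ξ t)) (perp (gradient (Φ t) x)) ∂(ρ t)
  simp only [flux, velocity, inner_add_left, real_inner_smul_left, F, max_eq_left (mem_Ici.1 ht)]
  have h1 : ∀ x, inner ℝ (coulomb (x - ξ t)) (perp (gradient (Φ t) x))
      = -inner ℝ (perp (coulomb (x - ξ t))) (gradient (Φ t) x) := fun x => by
    rw [inner_perp_left, neg_neg]
  simp only [h1]
  have i12 : Integrable (fun x => deriv (fun s => Φ s x) t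
      + inner ℝ (perp (field (ρ t) x)) (gradient (Φ t) x)) (ρ t) := i1.add i2
  rw [integral_neg, mul_neg, sub_neg_eq_add, ← integral_const_mul,
    ← integral_add i12 (i3.const_mul γ)]
  simp only [add_assoc]

/-! ### The total measure -/

instance isFiniteMeasure_totalMeasure (γ : ℝ) (μ : Measure Plane) [IsFiniteMeasure μ] (ζ : Plane) :
    IsFiniteMeasure (totalMeasure γ μ ζ) := by
  have : IsFiniteMeasure (ENNReal.ofReal γ • Measure.dirac ζ) :=
    Measure.smul_finite _ ENNReal.ofReal_ne_top
  unfold totalMeasure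
  infer_instance

theorem integrable_totalMeasure {E : Type*} [NormedAddCommGroup E] {γ : ℝ} {μ : Measure Plane}
    {ζ : Plane} {F : Plane → E} (hF : Integrable F μ) : Integrable F (totalMeasure γ μ ζ) :=
  hF.add_measure ((integrable_dirac (by finiteness)).smul_measure ENNReal.ofReal_ne_top)

theorem integral_totalMeasure {E : Type*} [NormedAddCommGroup E] [NormedSpace ℝ E]
    [CompleteSpace E] {γ : ℝ} (hγ : 0 ≤ γ) {μ : Measure Plane}
    {ζ : Plane} {F : Plane → E} (hF : Integrable F μ) :
    ∫ x, F x ∂(totalMeasure γ μ ζ) = ∫ x, F x ∂μ + γ • F ζ := by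
  rw [totalMeasure, integral_add_measure hF
    ((integrable_dirac (by finiteness)).smul_measure ENNReal.ofReal_ne_top),
    integral_smul_measure, integral_dirac, ENNReal.toReal_ofReal hγ]

theorem perp_field_totalMeasure {γ : ℝ} (hγ : 0 ≤ γ) {μ : Measure Plane} {x : Plane}
    (h : Integrable (fun y => coulomb (x - y)) μ) (ζ : Plane) :
    perp (field (totalMeasure γ μ ζ) x) = velocity γ μ ζ x := by
  rw [field, integral_totalMeasure hγ h, perp_add, perp_smul]
  rfl

theorem velocity_self (γ : ℝ) (μ : Measure Plane) (ζ : Plane) :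
    velocity γ μ ζ ζ = perp (field μ ζ) := by
  have : perp 0 = 0 := perpIso.map_zero
  simp [velocity, coulomb_zero, this]

/-- The uniform bound on the absolute field controls the plasma part. The Dirac part costs `γ |x -
ζ|⁻¹`, integrable against the plasma and equal to `0` at the charge itself. -/
theorem integrable_coulomb_prod {μ : Measure Plane} [IsFiniteMeasure μ] {γ : ℝ} (hγ : 0 ≤ γ)
    (h : ∀ x, Integrable (fun y => coulomb (x - y)) μ) {C : ℝ}
    (hC : ∀ x, ∫ y, ‖coulomb (x - y)‖ ∂μ ≤ C) (ζ : Plane) :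
    Integrable (fun z : Plane × Plane => coulomb (z.1 - z.2))
      ((totalMeasure γ μ ζ).prod (totalMeasure γ μ ζ)) := by
  have hm : AEStronglyMeasurable (fun z : Plane × Plane => coulomb (z.1 - z.2))
      ((totalMeasure γ μ ζ).prod (totalMeasure γ μ ζ)) :=
    (measurable_coulomb.comp (measurable_fst.sub measurable_snd)).aestronglyMeasurable
  refine (integrable_prod_iff hm).2
    ⟨Eventually.of_forall fun x => integrable_totalMeasure (h x), ?_⟩
  have hζ : Integrable (fun x => ‖coulomb (ζ - x)‖) (totalMeasure γ μ ζ) :=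
    integrable_totalMeasure (h ζ).norm
  refine ((integrable_const C).add (hζ.const_mul γ)).mono' hm.norm.integral_prod_right'
    (Eventually.of_forall fun x => ?_)
  rw [Real.norm_of_nonneg (integral_nonneg fun _ => norm_nonneg _),
    integral_totalMeasure hγ (h x).norm, smul_eq_mul, Pi.add_apply]
  gcongr
  · exact hC x
  · rw [← norm_neg, ← coulomb_neg, neg_sub]

theorem integral_deriv_add_hForm {ρ : ℝ → Measure Plane} (hρ : WeaklyContinuous ρ)
    (hN : NearFieldVanishes ρ) {γ : ℝ} (hγ : 0 ≤ γ) (ξ : ℝ → Plane)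
    {Φ : ℝ → Plane → ℝ} (hΦ : IsTest Φ) {t : ℝ} (ht : 0 ≤ t) :
    (∫ x, deriv (fun s => Φ s x) t ∂(totalMeasure γ (ρ t) (ξ t)))
      + hForm (Φ t) (totalMeasure γ (ρ t) (ξ t)) (totalMeasure γ (ρ t) (ξ t))
    = flux γ ρ ξ Φ t + γ * (deriv (fun s => Φ s (ξ t)) t
      + inner ℝ (perp (field (ρ t) (ξ t))) (gradient (Φ t) (ξ t))) := by
  have := hρ.finite t ht
  obtain ⟨C, -, hC⟩ := exists_integral_norm_coulomb_le hρ hN t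
  obtain ⟨B, hB⟩ := hΦ.exists_bound
  have hi := fun x => hN.integrable_coulomb hρ ht x
  rw [hForm_self (integrable_coulomb_prod hγ hi (hC t ⟨ht, le_rfl⟩) _)
    (hΦ.continuous_gradient_apply t) fun x => (hB t x).1]
  simp only [perp_field_totalMeasure hγ (hi _)]
  have i1 := hΦ.integrable_deriv t (ρ t)
  have i2 := hΦ.integrable_inner_gradient t (integrable_velocity hρ hN γ ht (ξ t))
  rw [integral_totalMeasure hγ i1, integral_totalMeasure hγ i2, velocity_self, flux,
    integral_add i1 i2]
  simp only [smul_eq_mul]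
  ring

theorem IsTest.integrable {Φ : ℝ → Plane → ℝ} (hΦ : IsTest Φ) (t : ℝ) (μ : Measure Plane)
    [IsFiniteMeasure μ] : Integrable (Φ t) μ := by
  obtain ⟨B, hB⟩ := hΦ.compact.exists_bound_of_continuous hΦ.smooth.continuous
  exact (integrable_const B).mono' (hΦ.smooth.continuous.comp
    (by fun_prop : Continuous fun x : Plane => (t, x))).aestronglyMeasurable
    (Eventually.of_forall fun x => hB (t, x))

/-! ### The transport equation with a source at the charge -/

theorem hasDerivAt_of_contDiffOn {ξ : ℝ → Plane} (hξ : ContDiffOn ℝ 1 ξ (Ici 0)) {t : ℝ}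
    (ht : 0 < t) : HasDerivAt ξ (derivWithin ξ (Ici 0) t) t :=
  ((hξ.differentiableOn one_ne_zero t ht.le).hasDerivWithinAt).hasDerivAt (Ici_mem_nhds ht)

theorem continuousOn_field_comp {ρ : ℝ → Measure Plane} (hρ : WeaklyContinuous ρ)
    (hN : NearFieldVanishes ρ) {ξ : ℝ → Plane} (hξ : ContinuousOn ξ (Ici 0)) :
    ContinuousOn (fun t => perp (field (ρ t) (ξ t))) (Ici 0) := by
  have h := (continuous_perp.comp (continuous_field hρ hN)).comp_continuousOn
    (continuousOn_id.prodMk hξ)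
  refine h.congr fun t ht => ?_
  simp [max_eq_left (mem_Ici.1 ht)]

theorem flux_eq_zero {γ : ℝ} {ρ : ℝ → Measure Plane} {ξ : ℝ → Plane} {Φ : ℝ → Plane → ℝ} {t : ℝ}
    (h : ∀ x, Φ t x = 0 ∧ deriv (fun s => Φ s x) t = 0 ∧ gradient (Φ t) x = 0) :
    flux γ ρ ξ Φ t = 0 := by
  simp [flux, (h _).2.1, (h _).2.2]

/-- In the combined equation the charge appears as if advected by `E^⊥`, whereas `Φ(t, ξ(t))`
changes with velocity `ξ'`. Subtracting its exact derivative leaves the velocity mismatch as a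
source on the trajectory. -/
theorem integral_flux_eq {γ : ℝ} (hγ : 0 ≤ γ) {ρ : ℝ → Measure Plane} (hρ : WeaklyContinuous ρ)
    (hN : NearFieldVanishes ρ) {ξ : ℝ → Plane} (hξ : ContDiffOn ℝ 1 ξ (Ici 0))
    {ν : ℝ → Fin 2 → Fin 2 → SignedMeasure Plane} (hν : IsDefectMeasure γ ρ ξ ν)
    (hν0 : ∀ᵐ t ∂(volume.restrict (Ioi (0 : ℝ))), ν t = 0)
    {Φ : ℝ → Plane → ℝ} (hΦ : IsTest Φ) :
    (∫ t in Ioi (0 : ℝ), flux γ ρ ξ Φ t) + ∫ x, Φ 0 x ∂(ρ 0)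
      = ∫ t in Ioi (0 : ℝ), γ * inner ℝ (gradient (Φ t) (ξ t))
          (derivWithin ξ (Ici 0) t - perp (field (ρ t) (ξ t))) := by
  obtain ⟨T, hT, h0⟩ := hΦ.exists_forall_eq_zero
  have hξc := hξ.continuousOn
  have hξ' : ContinuousOn (derivWithin ξ (Ici 0)) (Ici 0) :=
    hξ.continuousOn_derivWithin (uniqueDiffOn_Ici 0) le_rfl
  have hE := continuousOn_field_comp hρ hN hξc
  have hcurve : ContinuousOn (fun t => (t, ξ t)) (Ici 0) := continuousOn_id.prodMk hξc
  have cd : ContinuousOn (fun t => deriv (fun s => Φ s (ξ t)) t) (Ici 0) :=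
    hΦ.continuous_deriv.comp_continuousOn hcurve
  have cg : ContinuousOn (fun t => gradient (Φ t) (ξ t)) (Ici 0) :=
    hΦ.continuous_gradient.comp_continuousOn hcurve
  have cΦ : ContinuousOn (fun t => Φ t (ξ t)) (Ici 0) :=
    hΦ.smooth.continuous.comp_continuousOn hcurve
  have cf := continuousOn_flux hρ hN γ hξc hΦ
  have hmain := integral_add_initial_eq_zero
    (g := fun t => ∫ x, Φ t x ∂(ρ t) + γ * Φ t (ξ t))
    (G := fun t => flux γ ρ ξ Φ t + γ * (deriv (fun s => Φ s (ξ t)) t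
      + inner ℝ (perp (field (ρ t) (ξ t))) (gradient (Φ t) (ξ t))))
    ((hρ.continuousOn_integral hΦ.compact hΦ.smooth.continuous).add (cΦ.const_mul γ))
    (cf.add ((cd.add (hE.inner cg)).const_mul γ)) hT
    (fun t ht => by simp [(h0 t ht _).1])
    (fun t ht => by simp [flux_eq_zero (h0 t ht), (h0 t ht _).2.1, (h0 t ht _).2.2])
    (fun θ h1 h2 h3 => by
      refine Eq.trans ?_ ((hν.equation Φ hΦ θ h1 h2 h3).trans ?_)
      · congr 1
        refine setIntegral_congr_fun measurableSet_Ioi fun t ht => ?_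
        have := hρ.finite t (le_of_lt ht)
        rw [integral_totalMeasure hγ (hΦ.integrable t _), smul_eq_mul]
      · refine setIntegral_congr_ae measurableSet_Ioi ?_
        filter_upwards [(ae_restrict_iff' measurableSet_Ioi).1 hν0] with t h ht
        rw [h ht, integral_deriv_add_hForm hρ hN hγ ξ hΦ (le_of_lt ht)]
        simp)
  -- Fundamental theorem of calculus along the trajectory; it cancels the charge's share `γ Φ(0,
  -- ξ(0))` of the initial value.
  have hd : ∫ t in Ioi (0 : ℝ), (deriv (fun s => Φ s (ξ t)) t
      + inner ℝ (gradient (Φ t) (ξ t)) (derivWithin ξ (Ici 0) t)) = 0 - Φ 0 (ξ 0) := by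
    refine integral_Ioi_of_hasDerivAt_of_tendsto (f := fun t => Φ t (ξ t)) (cΦ 0 self_mem_Ici)
      (fun t ht => hΦ.hasDerivAt_comp (hasDerivAt_of_contDiffOn hξ ht))
      (integrableOn_Ioi_of_eq_zero (T := T) (cd.add (cg.inner hξ')) fun t ht => by
        simp [(h0 t ht _).2.1, (h0 t ht _).2.2]) ?_
    refine tendsto_const_nhds.congr' ?_
    filter_upwards [eventually_ge_atTop T] with t ht
    exact (h0 t ht _).1.symm
  have if1 : IntegrableOn (flux γ ρ ξ Φ) (Ioi 0) :=
    integrableOn_Ioi_of_eq_zero cf fun t ht => flux_eq_zero (h0 t ht)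
  have id1 : IntegrableOn (fun t => deriv (fun s => Φ s (ξ t)) t
      + inner ℝ (gradient (Φ t) (ξ t)) (derivWithin ξ (Ici 0) t)) (Ioi 0) :=
    integrableOn_Ioi_of_eq_zero (T := T) (cd.add (cg.inner hξ')) fun t ht => by
      simp [(h0 t ht _).2.1, (h0 t ht _).2.2]
  have ir : IntegrableOn (fun t => γ * inner ℝ (gradient (Φ t) (ξ t))
      (derivWithin ξ (Ici 0) t - perp (field (ρ t) (ξ t)))) (Ioi 0) :=
    integrableOn_Ioi_of_eq_zero (T := T) ((cg.inner (hξ'.sub hE)).const_mul γ) fun t ht => by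
      simp [(h0 t ht _).2.2]
  have hsplit : ∀ t, flux γ ρ ξ Φ t + γ * (deriv (fun s => Φ s (ξ t)) t
      + inner ℝ (perp (field (ρ t) (ξ t))) (gradient (Φ t) (ξ t)))
      = (flux γ ρ ξ Φ t + γ * (deriv (fun s => Φ s (ξ t)) t
        + inner ℝ (gradient (Φ t) (ξ t)) (derivWithin ξ (Ici 0) t)))
        - γ * inner ℝ (gradient (Φ t) (ξ t))
          (derivWithin ξ (Ici 0) t - perp (field (ρ t) (ξ t))) := fun t => by
    rw [inner_sub_right, real_inner_comm (gradient (Φ t) (ξ t)) (perp _)]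
    ring
  simp only [hsplit] at hmain
  have isum : IntegrableOn (fun t => flux γ ρ ξ Φ t + γ * (deriv (fun s => Φ s (ξ t)) t
      + inner ℝ (gradient (Φ t) (ξ t)) (derivWithin ξ (Ici 0) t))) (Ioi 0) :=
    if1.add (id1.const_mul γ)
  rw [integral_sub isum ir, integral_add if1 (id1.const_mul γ), integral_const_mul, hd] at hmain
  linarith

/-! ### The motion of the charge -/

/-- Test functions concentrated at scale `δ` near `(t₀, x₀)`, with gradient parallel to `a` close
to `x₀` and derivatives bounded independently of `δ`. -/
theorem exists_concentrated_test (a : Plane) {L : ℝ} (hL : 0 < L) :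
    ∃ C : ℝ, 0 ≤ C ∧ ∀ (t₀ : ℝ) (x₀ : Plane) (δ : ℝ), 0 < δ → ∃ (Φ : ℝ → Plane → ℝ) (θ : ℝ → ℝ),
      IsTest Φ ∧ (∀ t x, |deriv (fun s => Φ s x) t| ≤ C ∧ ‖gradient (Φ t) x‖ ≤ C) ∧
      (∀ t x, (δ < |t - t₀| ∨ (L + 1) * δ < ‖x - x₀‖) →
        Φ t x = 0 ∧ deriv (fun s => Φ s x) t = 0 ∧ gradient (Φ t) x = 0) ∧
      (∀ t, 0 ≤ θ t) ∧ (∀ t, |t - t₀| ≤ δ / 2 → θ t = 1) ∧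
      ∀ t x, ‖x - x₀‖ < L * δ → gradient (Φ t) x = θ t • a := by
  let θ : ContDiffBump (0 : ℝ) := ⟨1 / 2, 1, by norm_num, by norm_num⟩
  let χ : ContDiffBump (0 : Plane) := ⟨L, L + 1, hL, by linarith⟩
  -- The profile is linear in space with slope `a` on the inner ball, so its spatial gradient there
  -- is exactly a multiple of `a`.
  let b : ℝ × Plane → ℝ := fun w => θ w.1 * (χ w.2 * inner ℝ a w.2)
  have hb : ContDiff ℝ ∞ b := by
    refine (θ.contDiff.comp contDiff_fst).mul ((χ.contDiff.comp contDiff_snd).mul ?_)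
    exact contDiff_const.inner ℝ contDiff_snd
  have hbt : tsupport b ⊆ Metric.closedBall (0 : ℝ) 1 ×ˢ Metric.closedBall (0 : Plane) (L + 1) := by
    refine closure_minimal (fun w hw => ?_)
      (Metric.isClosed_closedBall.prod Metric.isClosed_closedBall)
    constructor
    · by_contra h
      refine hw ?_
      have : θ w.1 = 0 := θ.zero_of_le_dist (not_le.1 h).le
      simp [b, this]
    · by_contra h
      refine hw ?_
      have : χ w.2 = 0 := χ.zero_of_le_dist (not_le.1 h).le
      simp [b, this]
  have hbc : HasCompactSupport b :=
    ((isCompact_closedBall _ _).prod (isCompact_closedBall _ _)).of_isClosed_subset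
      (isClosed_tsupport b) hbt
  obtain ⟨C, hC⟩ := (hbc.fderiv ℝ).exists_bound_of_continuous (hb.continuous_fderiv (by simp))
  refine ⟨C, (norm_nonneg _).trans (hC 0), fun t₀ x₀ δ hδ => ?_⟩
  let A : ℝ × Plane → ℝ × Plane := fun z => δ⁻¹ • (z - (t₀, x₀))
  -- The prefactor `δ` cancels the `δ⁻¹` of the rescaling, so first derivatives are bounded
  -- independently of `δ`.
  let Φ : ℝ → Plane → ℝ := fun t x => δ * b (A (t, x))
  have hAs : ContDiff ℝ ∞ A := (contDiff_id.sub contDiff_const).const_smul _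
  have hΦ : IsTest Φ := by
    constructor
    · exact contDiff_const.mul (hb.comp hAs)
    · have h1 : HasCompactSupport (b ∘ A) := by
        let e : ℝ × Plane ≃ₜ ℝ × Plane :=
          (Homeomorph.subRight (t₀, x₀)).trans (Homeomorph.smulOfNeZero δ⁻¹ (inv_ne_zero hδ.ne'))
        exact hbc.comp_homeomorph e
      exact h1.mul_left (f := fun _ => δ)
  have hfd : ∀ z, fderiv ℝ (fun z : ℝ × Plane => Φ z.1 z.2) z = fderiv ℝ b (A z) := fun z => by
    have h1 : HasFDerivAt A (δ⁻¹ • ContinuousLinearMap.id ℝ (ℝ × Plane)) z :=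
      ((hasFDerivAt_id z).sub_const _).fun_const_smul _
    have h2 := ((hb.differentiable (by simp) (A z)).hasFDerivAt.comp z h1).const_mul δ
    rw [show fderiv ℝ (fun z : ℝ × Plane => Φ z.1 z.2) z = _ from h2.fderiv]
    ext w <;> simp [hδ.ne']
  have hzero : ∀ t x, (δ < |t - t₀| ∨ (L + 1) * δ < ‖x - x₀‖) → A (t, x) ∉ tsupport b := by
    intro t x h hA
    have h1 := hbt hA
    simp only [A, Prod.mk_sub_mk, Prod.smul_mk, mem_prod, mem_closedBall_zero_iff, norm_smul,
      norm_inv, Real.norm_of_nonneg hδ.le] at h1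
    rw [inv_mul_le_iff₀ hδ, inv_mul_le_iff₀ hδ, Real.norm_eq_abs] at h1
    rcases h with h | h
    · linarith [h1.1]
    · linarith [h1.2]
  refine ⟨Φ, fun t => θ (δ⁻¹ * (t - t₀)), hΦ, fun t x => ⟨?_, ?_⟩, fun t x h => ⟨?_, ?_, ?_⟩,
    fun t => θ.nonneg, fun t ht => ?_, fun t x hx => ?_⟩
  · rw [hΦ.deriv_eq (t, x), hfd, ← Real.norm_eq_abs]
    refine ((fderiv ℝ b _).le_opNorm _).trans ?_
    simpa [Prod.norm_def] using hC (A (t, x))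
  · rcases eq_or_ne (gradient (Φ t) x) 0 with h | h
    · rw [h, norm_zero]; exact (norm_nonneg _).trans (hC 0)
    have h1 : ‖gradient (Φ t) x‖ * ‖gradient (Φ t) x‖ ≤ C * ‖gradient (Φ t) x‖ := by
      rw [← real_inner_self_eq_norm_mul_norm, hΦ.inner_gradient (t, x), hfd]
      refine (le_abs_self _).trans (((fderiv ℝ b _).le_opNorm _).trans ?_)
      have : ‖((0 : ℝ), gradient (Φ t) x)‖ = ‖gradient (Φ t) x‖ := by simp [Prod.norm_def]
      rw [this]
      gcongr
      exact hC _
    exact le_of_mul_le_mul_right h1 (norm_pos_iff.2 h)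
  · have := image_eq_zero_of_notMem_tsupport (hzero t x h)
    simp [Φ, this]
  · have : fderiv ℝ b (A (t, x)) = 0 := by
      by_contra h1; exact hzero t x h (support_fderiv_subset ℝ h1)
    rw [hΦ.deriv_eq (t, x), hfd, this]; simp
  · have : fderiv ℝ b (A (t, x)) = 0 := by
      by_contra h1; exact hzero t x h (support_fderiv_subset ℝ h1)
    rw [hΦ.gradient_eq (t, x), hfd, this]; simp
  · refine θ.one_of_mem_closedBall ?_
    rw [mem_closedBall_zero_iff, norm_mul, norm_inv, Real.norm_of_nonneg hδ.le,
      inv_mul_le_iff₀ hδ, Real.norm_eq_abs]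
    simp only [θ]
    linarith
  · have hloc : Φ t =ᶠ[𝓝 x] fun y => θ (δ⁻¹ * (t - t₀)) * inner ℝ a (y - x₀) := by
      have : Metric.ball x₀ (L * δ) ∈ 𝓝 x :=
        Metric.isOpen_ball.mem_nhds (by rwa [Metric.mem_ball, dist_eq_norm])
      filter_upwards [this] with y hy
      rw [Metric.mem_ball, dist_eq_norm] at hy
      have h1 : χ (δ⁻¹ • (y - x₀)) = 1 := χ.one_of_mem_closedBall (by
        rw [mem_closedBall_zero_iff, norm_smul, norm_inv, Real.norm_of_nonneg hδ.le,
          inv_mul_le_iff₀ hδ]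
        simp only [χ]
        linarith)
      simp only [Φ, b, A, Prod.mk_sub_mk, Prod.smul_mk, h1, smul_eq_mul, real_inner_smul_right]
      field_simp
    have h2 : HasGradientAt (Φ t) (θ (δ⁻¹ * (t - t₀)) • a) x := by
      rw [hasGradientAt_iff_hasFDerivAt]
      refine HasFDerivAt.congr_of_eventuallyEq ?_ hloc
      have h3 : HasFDerivAt (fun y : Plane => inner ℝ a (y - x₀)) (innerSL ℝ a) x := by
        simpa [Function.comp_def] using
          (innerSL ℝ a).hasFDerivAt.comp x ((hasFDerivAt_id x).sub_const x₀)
      have h4 := h3.const_mul (θ (δ⁻¹ * (t - t₀)))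
      rw [map_smul]
      exact h4
    exact h2.gradient

/-- On the ball the kernel is at least `1/(3R)` when its pole is moved a distance `2R` from the
centre. A pole at the centre would miss an atom there, the kernel being `0` at the origin. -/
theorem NearFieldLE.measureReal_closedBall_le {μ : Measure Plane} [IsFiniteMeasure μ] {r ε : ℝ}
    (h : NearFieldLE μ r ε) (x : Plane) {R : ℝ} (hR : 0 < R) (hRr : 4 * R ≤ r) :
    μ.real (Metric.closedBall x R) ≤ 3 * R * ε := by
  let e : Plane := (2 * R) • EuclideanSpace.single 0 1
  have he : ‖e‖ = 2 * R := by
    simp [e, norm_smul, abs_of_pos hR]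
  calc μ.real (Metric.closedBall x R)
      = ∫ y, (Metric.closedBall x R).indicator 1 y ∂μ :=
        (integral_indicator_one Metric.isClosed_closedBall.measurableSet).symm
    _ ≤ ∫ y, 3 * R * nearKernel r (x + e - y) ∂μ := by
        refine integral_mono ((integrable_const (1 : ℝ)).indicator
          Metric.isClosed_closedBall.measurableSet) ((h _).1.const_mul _) fun y => ?_
        refine indicator_le' (f := (1 : Plane → ℝ))
          (g := fun y => 3 * R * nearKernel r (x + e - y)) (fun y hy => ?_) (fun y _ => ?_) y
        · rw [mem_closedBall_iff_norm'] at hy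
          have h1 : ‖x + e - y‖ ≤ 3 * R := by
            calc ‖x + e - y‖ = ‖(x - y) + e‖ := by congr 1; abel
              _ ≤ ‖x - y‖ + ‖e‖ := norm_add_le _ _
              _ ≤ 3 * R := by linarith
          have h2 : R ≤ ‖x + e - y‖ := by
            have : ‖e‖ ≤ ‖x + e - y‖ + ‖x - y‖ := by
              calc ‖e‖ = ‖(x + e - y) - (x - y)‖ := by congr 1; abel
                _ ≤ _ := norm_sub_le _ _
            linarith
          rw [nearKernel_of_lt (by linarith), Pi.one_apply, ← div_eq_mul_inv,
            one_le_div (by linarith)]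
          exact h1
        · exact mul_nonneg (by positivity) (nearKernel_nonneg _ _)
    _ ≤ 3 * R * ε := by
        rw [integral_const_mul]
        gcongr
        exact (h _).2

/-- The time derivative and the bounded field are integrated over a ball of small `ρ`-mass; the
singular velocity created by the charge is there dominated by the near kernel with pole `ξ t`. -/
theorem abs_flux_le {γ : ℝ} (hγ : 0 ≤ γ) {ρ : ℝ → Measure Plane} {ξ : ℝ → Plane}
    {Φ : ℝ → Plane → ℝ} {t r ε M C R : ℝ} [IsFiniteMeasure (ρ t)]
    (hnear : NearFieldLE (ρ t) r ε) (hM0 : 0 ≤ M) (hM : ∀ x, ‖field (ρ t) x‖ ≤ M) (hC0 : 0 ≤ C)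
    (hC : ∀ x, |deriv (fun s => Φ s x) t| ≤ C ∧ ‖gradient (Φ t) x‖ ≤ C) {x₀ : Plane}
    (hR : 0 < R) (hRr : 4 * R ≤ r) (hξ : ‖ξ t - x₀‖ ≤ R)
    (hsupp : ∀ x, R < ‖x - x₀‖ → deriv (fun s => Φ s x) t = 0 ∧ gradient (Φ t) x = 0) :
    |flux γ ρ ξ Φ t| ≤ C * (1 + M) * (3 * R * ε) + C * γ * ε := by
  have hind : Integrable (fun x => (Metric.closedBall x₀ R).indicator (1 : Plane → ℝ) x) (ρ t) :=
    (integrable_const (1 : ℝ)).indicator Metric.isClosed_closedBall.measurableSet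
  have hpt : ∀ x, ‖deriv (fun s => Φ s x) t
      + inner ℝ (velocity γ (ρ t) (ξ t) x) (gradient (Φ t) x)‖
      ≤ C * (1 + M) * (Metric.closedBall x₀ R).indicator (1 : Plane → ℝ) x
        + C * γ * nearKernel r (ξ t - x) := fun x => by
    by_cases hx : ‖x - x₀‖ ≤ R
    · rw [indicator_of_mem (by rwa [mem_closedBall_iff_norm]), Pi.one_apply, mul_one]
      have h1 : ‖ξ t - x‖ < r := by
        calc ‖ξ t - x‖ = ‖(ξ t - x₀) - (x - x₀)‖ := by congr 1; abel
          _ ≤ ‖ξ t - x₀‖ + ‖x - x₀‖ := norm_sub_le _ _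
          _ < r := by linarith
      have h2 : ‖velocity γ (ρ t) (ξ t) x‖ ≤ M + γ * nearKernel r (ξ t - x) := by
        rw [nearKernel_of_lt h1]
        refine (norm_add_le _ _).trans (add_le_add ?_ ?_)
        · rw [norm_perp]; exact hM x
        · rw [norm_smul, norm_perp, norm_coulomb, Real.norm_of_nonneg hγ, norm_sub_rev]
      calc _ ≤ ‖deriv (fun s => Φ s x) t‖
            + ‖velocity γ (ρ t) (ξ t) x‖ * ‖gradient (Φ t) x‖ :=
            (norm_add_le _ _).trans (add_le_add le_rfl (norm_inner_le_norm _ _))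
        _ ≤ C + (M + γ * nearKernel r (ξ t - x)) * C := by
            refine add_le_add (hC x).1 (mul_le_mul h2 (hC x).2 (norm_nonneg _)
              ((norm_nonneg _).trans h2))
        _ = _ := by ring
    · obtain ⟨h1, h2⟩ := hsupp x (not_le.1 hx)
      rw [h1, h2, inner_zero_right, add_zero, norm_zero]
      refine add_nonneg (mul_nonneg (by positivity) (indicator_nonneg (by simp) _))
        (mul_nonneg (by positivity) (nearKernel_nonneg _ _))
  calc |flux γ ρ ξ Φ t|
      ≤ ∫ x, (C * (1 + M) * (Metric.closedBall x₀ R).indicator (1 : Plane → ℝ) x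
        + C * γ * nearKernel r (ξ t - x)) ∂(ρ t) :=
        norm_integral_le_of_norm_le ((hind.const_mul _).add ((hnear _).1.const_mul _))
          (Eventually.of_forall hpt)
    _ = C * (1 + M) * (ρ t).real (Metric.closedBall x₀ R)
        + C * γ * ∫ x, nearKernel r (ξ t - x) ∂(ρ t) := by
        rw [integral_add (hind.const_mul _) ((hnear _).1.const_mul _), integral_const_mul,
          integral_const_mul, integral_indicator_one Metric.isClosed_closedBall.measurableSet]
    _ ≤ _ := by
        gcongr
        · exact hnear.measureReal_closedBall_le x₀ hR hRr
        · exact (hnear _).2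

theorem derivWithin_eq_perp_field {γ : ℝ} (hγ : 0 < γ) {ρ : ℝ → Measure Plane}
    (hρ : WeaklyContinuous ρ) (hN : NearFieldVanishes ρ) {ξ : ℝ → Plane}
    (hξ : ContDiffOn ℝ 1 ξ (Ici 0))
    {ν : ℝ → Fin 2 → Fin 2 → SignedMeasure Plane} (hν : IsDefectMeasure γ ρ ξ ν)
    (hν0 : ∀ᵐ t ∂(volume.restrict (Ioi (0 : ℝ))), ν t = 0) {t₀ : ℝ} (ht₀ : 0 < t₀) :
    derivWithin ξ (Ici 0) t₀ = perp (field (ρ t₀) (ξ t₀)) := by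
  let h : ℝ → Plane := fun t => derivWithin ξ (Ici 0) t - perp (field (ρ t) (ξ t))
  have hc : ContinuousOn h (Ici 0) :=
    (hξ.continuousOn_derivWithin (uniqueDiffOn_Ici 0) le_rfl).sub
      (continuousOn_field_comp hρ hN hξ.continuousOn)
  by_contra hne
  set a : Plane := h t₀ with ha
  have ha0 : a ≠ 0 := sub_ne_zero.2 hne
  have ha1 : 0 < ‖a‖ ^ 2 := by positivity
  -- Differentiability at `t₀` bounds the displacement by `c |t - t₀|` nearby; with `L = |c| + 1`
  -- the charge stays in the ball of radius `L δ`, where the gradient is along `a`.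
  obtain ⟨c, hcb⟩ := (hasDerivAt_of_contDiffOn hξ ht₀).isBigO_sub.bound
  set L : ℝ := |c| + 1 with hL
  have hL0 : 0 < L := by positivity
  obtain ⟨C, hC0, hC⟩ := exists_concentrated_test a hL0
  obtain ⟨M, hM0, hM⟩ := exists_norm_field_le hρ hN (t₀ + 1)
  -- Chosen so that the flux is at most `γ‖a‖²/8` on a window of length `2δ`, giving `γ‖a‖²δ/4`
  -- against the lower bound `γ‖a‖²δ/2`. The constant `C` depends on `a` and `L` but not on `δ`,
  -- which is chosen last.
  set ε : ℝ := γ * ‖a‖ ^ 2 / 8 / (3 * C * (1 + M) + C * γ + 1) with hε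
  have hden : 0 < 3 * C * (1 + M) + C * γ + 1 := by positivity
  have hε0 : 0 < ε := by positivity
  have hε1 : (3 * C * (1 + M) + C * γ) * ε ≤ γ * ‖a‖ ^ 2 / 8 := by
    rw [hε, mul_div_assoc', div_le_iff₀ hden, mul_comm]
    exact mul_le_mul_of_nonneg_left (by linarith) (by positivity)
  obtain ⟨r, hr, hnear⟩ := hN (t₀ + 1) ε hε0
  have hinner : ∀ᶠ t in 𝓝 t₀, ‖a‖ ^ 2 / 2 ≤ inner ℝ a (h t) := by
    have h1 : Tendsto (fun t => inner ℝ a (h t)) (𝓝 t₀) (𝓝 (inner ℝ a a)) :=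
      tendsto_const_nhds.inner (hc.continuousAt (Ici_mem_nhds ht₀))
    rw [real_inner_self_eq_norm_sq] at h1
    exact h1.eventually (le_mem_nhds (by linarith))
  obtain ⟨κ, hκ, hball⟩ := Metric.eventually_nhds_iff.1 (hcb.and hinner)
  obtain ⟨δ, hδ0, hδ⟩ : ∃ δ : ℝ, 0 < δ ∧ (δ < κ ∧ δ < t₀ ∧ δ < 1 ∧ (L + 1) * δ ≤ 1 ∧
      4 * ((L + 1) * δ) ≤ r) := by
    have h1 : Tendsto (fun δ : ℝ => δ) (𝓝[>] 0) (𝓝 0) := nhdsWithin_le_nhds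
    have h2 : Tendsto (fun δ : ℝ => (L + 1) * δ) (𝓝[>] 0) (𝓝 0) := by
      simpa using h1.const_mul (L + 1)
    have h3 : Tendsto (fun δ : ℝ => 4 * ((L + 1) * δ)) (𝓝[>] 0) (𝓝 0) := by
      simpa using h2.const_mul 4
    have := (h1.eventually (gt_mem_nhds hκ)).and ((h1.eventually (gt_mem_nhds ht₀)).and
      ((h1.eventually (gt_mem_nhds one_pos)).and ((h2.eventually (ge_mem_nhds one_pos)).and
      (h3.eventually (ge_mem_nhds hr)))))
    obtain ⟨δ, h4, h5⟩ := (this.and self_mem_nhdsWithin).exists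
    exact ⟨δ, h5, h4⟩
  obtain ⟨hδκ, hδt, hδ1, hδR, hδr⟩ := hδ
  obtain ⟨Φ, θ, hΦ, hΦC, hΦ0, hθ0, hθ1, hgrad⟩ := hC t₀ (ξ t₀) δ hδ0
  have hclose : ∀ t, |t - t₀| ≤ δ → ‖ξ t - ξ t₀‖ < L * δ ∧ ‖a‖ ^ 2 / 2 ≤ inner ℝ a (h t) := by
    intro t ht
    obtain ⟨h1, h2⟩ := hball (show dist t t₀ < κ by rw [Real.dist_eq]; linarith)
    refine ⟨h1.trans_lt ?_, h2⟩
    rw [Real.norm_eq_abs]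
    calc c * |t - t₀| ≤ |c| * δ :=
          mul_le_mul (le_abs_self _) ht (abs_nonneg _) (abs_nonneg _)
      _ < L * δ := by gcongr; linarith
  have hkey := integral_flux_eq hγ.le hρ hN hξ hν hν0 hΦ
  have hinit : ∫ x, Φ 0 x ∂(ρ 0) = 0 := by
    have : ∀ x, Φ 0 x = 0 := fun x =>
      (hΦ0 0 x (Or.inl (by rw [zero_sub, abs_neg, abs_of_pos ht₀]; exact hδt))).1
    simp [this]
  rw [hinit, add_zero] at hkey
  -- upper bound of the left-hand side
  have hsub : Icc (t₀ - δ) (t₀ + δ) ⊆ Ioi 0 := fun t ht => by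
    have := ht.1
    exact mem_Ioi.2 (by linarith)
  have hwin : ∀ t, t ∉ Icc (t₀ - δ) (t₀ + δ) → δ < |t - t₀| := fun t ht => by
    by_contra h1
    rw [not_lt, abs_le] at h1
    exact ht ⟨by linarith [h1.1], by linarith [h1.2]⟩
  have hupper : |∫ t in Ioi (0 : ℝ), flux γ ρ ξ Φ t| ≤ γ * ‖a‖ ^ 2 / 8 * (2 * δ) := by
    rw [setIntegral_eq_of_subset_of_forall_sdiff_eq_zero measurableSet_Ioi hsub
      fun t ht => flux_eq_zero fun x => hΦ0 t x (Or.inl (hwin t ht.2))]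
    rw [← Real.norm_eq_abs]
    refine (norm_setIntegral_le_of_norm_le_const (C := γ * ‖a‖ ^ 2 / 8)
      (measure_Icc_lt_top (μ := (volume : Measure ℝ))) fun t ht => ?_).trans (le_of_eq ?_)
    · rw [Real.norm_eq_abs]
      have ht0 : 0 ≤ t := le_of_lt (hsub ht)
      have htT : t ∈ Icc 0 (t₀ + 1) := ⟨ht0, by linarith [ht.2]⟩
      have := hρ.finite t ht0
      have htδ : |t - t₀| ≤ δ := abs_le.2 ⟨by linarith [ht.1], by linarith [ht.2]⟩
      have hR : 0 < (L + 1) * δ := by positivity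
      have := abs_flux_le hγ.le (ξ := ξ) (Φ := Φ) (hnear t htT) hM0 (hM t htT) hC0 (hΦC t)
        (x₀ := ξ t₀) hR hδr ((hclose t htδ).1.le.trans (by linarith))
        (fun x hx => (hΦ0 t x (Or.inr hx)).2)
      refine this.trans (le_trans ?_ hε1)
      -- Uses `(L + 1) δ ≤ 1`.
      have h3 : 3 * ((L + 1) * δ) * ε ≤ 3 * ε := by nlinarith
      have : C * (1 + M) * (3 * ((L + 1) * δ) * ε) ≤ C * (1 + M) * (3 * ε) := by gcongr
      linarith
    · rw [Real.volume_real_Icc_of_le (by linarith)]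
      ring
  -- lower bound of the right-hand side
  have hterm : ∀ t, |t - t₀| ≤ δ → inner ℝ (gradient (Φ t) (ξ t)) (h t) = θ t * inner ℝ a (h t) :=
    fun t ht => by rw [hgrad t (ξ t) (hclose t ht).1, real_inner_smul_left]
  have hpos : ∀ t, 0 ≤ γ * inner ℝ (gradient (Φ t) (ξ t)) (h t) := fun t => by
    refine mul_nonneg hγ.le ?_
    rcases le_or_gt |t - t₀| δ with h1 | h1
    · rw [hterm t h1]
      exact mul_nonneg (hθ0 t) (by linarith [(hclose t h1).2])
    · rw [(hΦ0 t (ξ t) (Or.inl h1)).2.2, inner_zero_left]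
  have hint : IntegrableOn (fun t => γ * inner ℝ (gradient (Φ t) (ξ t)) (h t)) (Ioi 0) := by
    obtain ⟨T, -, h0⟩ := hΦ.exists_forall_eq_zero
    refine integrableOn_Ioi_of_eq_zero (T := T) ?_ fun t ht => by simp [(h0 t ht _).2.2]
    exact ((hΦ.continuous_gradient.comp_continuousOn
      (continuousOn_id.prodMk hξ.continuousOn)).inner hc).const_mul γ
  have hsub' : Icc (t₀ - δ / 2) (t₀ + δ / 2) ⊆ Ioi 0 := fun t ht => by
    have := ht.1
    exact mem_Ioi.2 (by linarith)
  have hlower : γ * ‖a‖ ^ 2 / 2 * δ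
      ≤ ∫ t in Ioi (0 : ℝ), γ * inner ℝ (gradient (Φ t) (ξ t)) (h t) := by
    calc γ * ‖a‖ ^ 2 / 2 * δ
        = ∫ _t in Icc (t₀ - δ / 2) (t₀ + δ / 2), γ * ‖a‖ ^ 2 / 2 := by
          rw [setIntegral_const, Real.volume_real_Icc_of_le (by linarith), smul_eq_mul]
          ring
      _ ≤ ∫ t in Icc (t₀ - δ / 2) (t₀ + δ / 2), γ * inner ℝ (gradient (Φ t) (ξ t)) (h t) := by
          refine setIntegral_mono_on (by simp) (hint.mono_set hsub') measurableSet_Icc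
            fun t ht => ?_
          have h1 : |t - t₀| ≤ δ / 2 := abs_le.2 ⟨by linarith [ht.1], by linarith [ht.2]⟩
          rw [hterm t (by linarith), hθ1 t h1, one_mul, mul_div_assoc]
          gcongr
          exact (hclose t (by linarith)).2
      _ ≤ _ := setIntegral_mono_set hint (Eventually.of_forall hpos)
          (Eventually.of_forall hsub')
  rw [← hkey] at hlower
  have h1 := hlower.trans ((le_abs_self _).trans hupper)
  have h2 : 0 < γ * ‖a‖ ^ 2 * δ := by positivity
  linarith

theorem hasDerivWithinAt_charge {γ : ℝ} (hγ : 0 < γ) {ρ : ℝ → Measure Plane}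
    (hρ : WeaklyContinuous ρ) (hN : NearFieldVanishes ρ) {ξ : ℝ → Plane}
    (hξ : ContDiffOn ℝ 1 ξ (Ici 0))
    {ν : ℝ → Fin 2 → Fin 2 → SignedMeasure Plane} (hν : IsDefectMeasure γ ρ ξ ν)
    (hν0 : ∀ᵐ t ∂(volume.restrict (Ioi (0 : ℝ))), ν t = 0) {t : ℝ} (ht : 0 ≤ t) :
    HasDerivWithinAt ξ (perp (field (ρ t) (ξ t))) (Ici 0) t := by
  have heq : EqOn (derivWithin ξ (Ici 0)) (fun t => perp (field (ρ t) (ξ t))) (Ici 0) := by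
    refine EqOn.of_subset_closure (s := Ioi 0)
      (fun s hs => derivWithin_eq_perp_field hγ hρ hN hξ hν hν0 hs)
      (hξ.continuousOn_derivWithin (uniqueDiffOn_Ici 0) le_rfl)
      (continuousOn_field_comp hρ hN hξ.continuousOn) Ioi_subset_Ici_self ?_
    rw [closure_Ioi]
  rw [← show derivWithin ξ (Ici 0) t = perp (field (ρ t) (ξ t)) from heq ht]
  exact (hξ.differentiableOn one_ne_zero t ht).hasDerivWithinAt

/-! ### Assembly of the vortex-wave solution -/

theorem isVortexWaveSolution {γ : ℝ} (hγ : 0 < γ) {ρ : ℝ → Measure Plane}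
    (hρ : WeaklyContinuous ρ) (hN : NearFieldVanishes ρ) {ξ : ℝ → Plane}
    (hξ : ContDiffOn ℝ 1 ξ (Ici 0))
    {ν : ℝ → Fin 2 → Fin 2 → SignedMeasure Plane} (hν : IsDefectMeasure γ ρ ξ ν)
    (hν0 : ∀ᵐ t ∂(volume.restrict (Ioi (0 : ℝ))), ν t = 0) :
    IsVortexWaveSolution γ ρ ξ where
  field_integrable t ht x := hN.integrable_coulomb hρ ht x
  velocity_integrable t ht := integrable_velocity hρ hN γ ht (ξ t)
  flux_integrable Φ hΦ := by
    obtain ⟨T, -, h0⟩ := hΦ.exists_forall_eq_zero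
    exact integrableOn_Ioi_of_eq_zero (continuousOn_flux hρ hN γ hξ.continuousOn hΦ)
      fun t ht => flux_eq_zero (h0 t ht)
  transport Φ hΦ := by
    refine (integral_flux_eq hγ.le hρ hN hξ hν hν0 hΦ).trans ?_
    refine (setIntegral_congr_fun measurableSet_Ioi fun t ht => ?_).trans (integral_zero _ _)
    rw [derivWithin_eq_perp_field hγ hρ hN hξ hν hν0 ht, sub_self, inner_zero_right, mul_zero]
  charge t ht := hasDerivWithinAt_charge hγ hρ hN hξ hν hν0 ht

end

end VortexWave

open VortexWave in
theorem theorem1p3 (γ : ℝ) (hγ : 0 < γ)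
    (f₀ : ℝ → Plane × Plane → ℝ) (ξ₀ η₀ : ℝ → Plane) (hdata : AdmissibleData γ f₀ ξ₀ η₀)
    (f : ℝ → ℝ → Plane × Plane → ℝ) (ξε ηε : ℝ → ℝ → Plane)
    (hsol : ∀ ε ∈ Set.Ioo (0 : ℝ) 1,
      IsKineticSolution γ ε (f₀ ε) (ξ₀ ε) (η₀ ε) (f ε) (ξε ε) (ηε ε))
    (ρ : ℝ → MeasureTheory.Measure Plane) (ξ : ℝ → Plane)
    (hacc : IsAccumulationPoint f ξε ρ ξ)
    (ν : ℝ → Fin 2 → Fin 2 → MeasureTheory.SignedMeasure Plane)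
    (hν : IsDefectMeasure γ ρ ξ ν)
    (hν0 : ∀ᵐ t ∂(MeasureTheory.volume.restrict (Set.Ioi (0 : ℝ))), ν t = 0)
    (p : ENNReal) (hp : 2 < p) (hρ : LocallyBoundedInLp p ρ)
    (hξ : ContDiffOn ℝ 1 ξ (Set.Ici 0)) :
    IsVortexWaveSolution γ ρ ξ := by
  exact isVortexWaveSolution hγ hacc.1
    (fun T _ hε => exists_nearFieldLE hacc.1 hp hρ T hε) hξ hν hν0
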